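/- Let $d\ge 1$ and $\rho\in(0,\infty)$. For $g\in L^2(\mathbb{R}^d)$ (real-valued) put $\mathcal H(g^2)=\rho\int_{\mathbb{R}^d} g^2(x)\log g^2(x)\,dx$ (with $0\log 0=0$), and for continuous $\psi\colon\mathbb{R}^d\to\mathbb{R}$ put $\langle\psi,g^2\rangle=\int_{\mathbb{R}^d}\psi g^2\,dx$ and $$\mathcal L(\psi)=\sup_{g\in L^2(\mathbb{R}^d)}\bigl\{\langle g^2,\psi\rangle-\mathcal H(g^2)\bigr\},\qquad \lambda(\psi)=\sup_{g\in H^1(\mathbb{R}^d),\ \|g\|_2=1}\bigl\{\langle\psi,g^2\rangle-\|\nabla g\|_2^2\bigr\},$$ where integrals and suprema take values in $[-\infty,\infty]$ and each supremum is over those $g$ for which the expression is well defined. Further put $$\chi(\rho)=\inf_{g\in H^1(\mathbb{R}^d),\ \|g\|_2=1}\bigl\{\|\nabla g\|_2^2-\mathcal H(g^2)\bigr\},\qquad \widetilde\chi(\rho)=\inf\bigl\{-\lambda(\psi)\colon \psi\colon\mathbb{R}^d\to\mathbb{R}\text{ continuous},\ \mathcal L(\psi)\le 1\bigr\},$$ and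 $\psi_\rho(x)=\rho+\rho\frac d2\log\frac\rho\pi-\rho^2|x|^2$. Then the function $\psi_\rho-\rho\log\rho$ is a minimiser in the definition of $\widetilde\chi(\rho)$, and it is unique up to spatial shift: the minimisers are exactly the functions $x\mapsto\psi_\rho(x-a)-\rho\log\rho$ with $a\in\mathbb{R}^d$. Moreover, $\chi(\rho)$ and $\widetilde\chi(\rho)$ are finite and $$\widetilde\chi(\rho)=\chi(\rho)+\rho\log\frac{\rho}{e}.$$ -/

import Mathlib

open MeasureTheory
open scoped ENNReal ContDiff

noncomputable section

namespace AlmostBounded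

/-- The Euclidean space `ℝ^d`. -/
abbrev Space (d : ℕ) : Type := EuclideanSpace ℝ (Fin d)

/-- The extended Lebesgue integral `∫ f = ∫ f⁺ - ∫ f⁻` with values in `[-∞, ∞]`; it is meaningful
if `f` is quasi-integrable (see below). -/
def extIntegral {d : ℕ} (f : Space d → ℝ) : EReal :=
  ((∫⁻ x, ENNReal.ofReal (f x) : ℝ≥0∞) : EReal) - ((∫⁻ x, ENNReal.ofReal (-f x) : ℝ≥0∞) : EReal)

/-- The integral `∫ f` is well defined in `[-∞, ∞]`: not both of `∫ f⁺`, `∫ f⁻` are infinite. -/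
def QuasiIntegrable {d : ℕ} (f : Space d → ℝ) : Prop :=
  (∫⁻ x, ENNReal.ofReal (f x)) ≠ ⊤ ∨ (∫⁻ x, ENNReal.ofReal (-f x)) ≠ ⊤

/-- The vector field `v` is the distributional gradient of `g`:
`∫ g ∂_w φ = - ∫ φ ⟨v, w⟩` for every direction `w` and every test function `φ`. -/
def IsWeakGradient {d : ℕ} (g : Space d → ℝ) (v : Space d → Space d) : Prop :=
  ∀ φ : Space d → ℝ, ContDiff ℝ ∞ φ → HasCompactSupport φ → ∀ w : Space d,
    ∫ x, g x * fderiv ℝ φ x w = - ∫ x, φ x * inner ℝ (v x) w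

/-- `g` belongs to the Sobolev space `H¹(ℝ^d)` and `v` is its distributional gradient (which is
determined by `g` up to a null set). -/
def IsH1 {d : ℕ} (g : Space d → ℝ) (v : Space d → Space d) : Prop :=
  MemLp g 2 volume ∧ MemLp v 2 volume ∧ IsWeakGradient g v

/-- The entropy functional `𝓗(g²) = ρ ∫ g² log g²`, with `0 log 0 = 0`. -/
def entropy {d : ℕ} (ρ : ℝ) (g : Space d → ℝ) : EReal :=
  (ρ : EReal) * extIntegral (fun x => g x ^ 2 * Real.log (g x ^ 2))

/-- The pairing `⟨ψ, g²⟩ = ∫ ψ g²`. -/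
def pairing {d : ℕ} (ψ g : Space d → ℝ) : EReal :=
  extIntegral (fun x => ψ x * g x ^ 2)

/-- `χ(ρ) = inf {‖∇g‖₂² - 𝓗(g²) : g ∈ H¹(ℝ^d), ‖g‖₂ = 1}`. -/
def chi (d : ℕ) (ρ : ℝ) : EReal :=
  sInf {a : EReal | ∃ (g : Space d → ℝ) (v : Space d → Space d),
    IsH1 g v ∧ eLpNorm g 2 volume = 1 ∧
    a = ((∫ x, ‖v x‖ ^ 2 : ℝ) : EReal) - entropy ρ g}

/-- The Legendre transform `𝓛(ψ) = sup {⟨g², ψ⟩ - 𝓗(g²) : g ∈ L²(ℝ^d)}`. The supremum runs over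
those `g` for which both terms are well defined; an expression `∞ - ∞` has the value `-∞` in
`EReal`, so that it does not contribute to the supremum. -/
def legendre {d : ℕ} (ρ : ℝ) (ψ : Space d → ℝ) : EReal :=
  sSup {a : EReal | ∃ g : Space d → ℝ, MemLp g 2 volume ∧
    QuasiIntegrable (fun x => ψ x * g x ^ 2) ∧
    QuasiIntegrable (fun x => g x ^ 2 * Real.log (g x ^ 2)) ∧
    a = pairing ψ g - entropy ρ g}

/-- The top of the spectrum of `Δ + ψ`:
`λ(ψ) = sup {⟨ψ, g²⟩ - ‖∇g‖₂² : g ∈ H¹(ℝ^d), ‖g‖₂ = 1}`, the supremum being over those `g` for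
which `⟨ψ, g²⟩` is well defined. -/
def spectralTop {d : ℕ} (ψ : Space d → ℝ) : EReal :=
  sSup {a : EReal | ∃ (g : Space d → ℝ) (v : Space d → Space d),
    IsH1 g v ∧ eLpNorm g 2 volume = 1 ∧ QuasiIntegrable (fun x => ψ x * g x ^ 2) ∧
    a = pairing ψ g - ((∫ x, ‖v x‖ ^ 2 : ℝ) : EReal)}

/-- `χ̃(ρ) = inf {-λ(ψ) : ψ continuous, 𝓛(ψ) ≤ 1}`. -/
def chiTilde (d : ℕ) (ρ : ℝ) : EReal :=
  sInf {a : EReal | ∃ ψ : Space d → ℝ,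
    Continuous ψ ∧ legendre ρ ψ ≤ 1 ∧ a = - spectralTop ψ}

/-- `ψ` is admissible in the variational problem for `χ̃(ρ)` and attains the infimum. -/
def IsMinimizer {d : ℕ} (ρ : ℝ) (ψ : Space d → ℝ) : Prop :=
  Continuous ψ ∧ legendre ρ ψ ≤ 1 ∧ - spectralTop ψ = chiTilde d ρ

/-- The parabola `ψ_ρ(x) = ρ + ρ (d/2) log (ρ/π) - ρ² |x|²`. -/
def parabola (d : ℕ) (ρ : ℝ) (x : Space d) : ℝ :=
  ρ + ρ * ((d : ℝ) / 2) * Real.log (ρ / Real.pi) - ρ ^ 2 * ‖x‖ ^ 2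

end AlmostBounded

end

noncomputable section

namespace AlmostBounded
open Filter Topology

/-! Write Z = ∫ exp(ψ/ρ). Maximising ψu - ρ u log u pointwise over u ≥ 0 gives ρ exp(ψ/ρ - 1), so
the constraint 𝓛(ψ) ≤ 1 says exactly Z ≤ e/ρ (`legendre_le_one`,
`lintegral_exp_le_of_legendre_le_one`). Everything then rests on the dual logarithmic Sobolev
inequality λ(ψ) ≤ ρ log Z - χ(ρ).

That inequality is proved by mass transport (`IsH1.exists_log_bound`). The Knothe map sends the
density F = exp(ψ/ρ), normalised, to the Gaussian with variance 1/(2ρ) in each coordinate. Its j-th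
component T_j increases in the j-th coordinate with derivative D_j, and log(F/Z) is the sum over j
of log D_j + (1/2) log(ρ/π) - ρ T_j². Apply log D_j ≤ D_j - 1, multiply by ρ g² and integrate. The
terms ρ D_j g² are controlled by ∫ ∂_j X g² = -2 ∫ X g ∂_j g ≤ ‖∂_j g‖² + ‖X g‖² with X = ρ T_j, and
the T_j² terms cancel. To keep X bounded, only the central part of mass κ < 1 of the Gaussian is
used as target, at a cost -dρ log κ.

With F close to g² this bounds χ(ρ) from below, and with F = exp(ψ/ρ) it bounds λ from above; the
Gaussian ground state and the parabola attain both bounds.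

For uniqueness no maximiser g of λ(ψ) is needed. The loss D - 1 - log D in the last coordinate is
kept as a remainder η, truncated to [0, 1]. For a nearly optimal g the inequality for F makes ∫ η g²
small; the inequality for F exp(-η) with the same g then makes ∫ η F small
(`IsMinimizer.lintegral_truncatedRemainder_le`). As κ → 1 this forces D = 1, so ψ is a parabola with
leading coefficient -ρ² on every line in the last coordinate direction. Minimisers are invariant
under isometries, hence the same holds in every direction, ψ + ρ²|x|² is affine, and the additive
constant is fixed by the constraint and by optimality. -/

/-! ### Integration by parts against g² for Sobolev functions, via difference quotients. -/

lemma hasDerivAt_integral_mul_translate {d : ℕ} {g : Space d → ℝ} (hg : LocallyIntegrable g volume)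
    {φ : Space d → ℝ} (hφ : ContDiff ℝ ∞ φ) (hc : HasCompactSupport φ) (w : Space d) (s : ℝ) :
    HasDerivAt (fun s : ℝ => ∫ x, g x * φ (x - s • w))
      (-∫ x, g x * fderiv ℝ φ (x - s • w) w) s := by
  -- The integral is the convolution of g with the reflected test function, evaluated at s • w.
  set h : Space d → ℝ := fun y => φ (-y) with hh
  have hφ1 : ContDiff ℝ 1 φ := hφ.of_le (by exact_mod_cast le_top)
  have hh1 : ContDiff ℝ 1 h := hφ1.comp contDiff_neg
  have hhc : HasCompactSupport h := hc.comp_homeomorph (Homeomorph.neg (Space d))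
  have hfd : ∀ y, fderiv ℝ h y w = -fderiv ℝ φ (-y) w := by
    intro y
    have h1 : HasFDerivAt φ (fderiv ℝ φ (-y)) (-y) :=
      (hφ1.differentiable one_ne_zero).differentiableAt.hasFDerivAt
    have h2 : HasFDerivAt (fun y : Space d => -y) (-ContinuousLinearMap.id ℝ (Space d)) y :=
      (hasFDerivAt_id y).neg
    have := (h1.comp y h2).fderiv
    have h3 : fderiv ℝ h y = (fderiv ℝ φ (-y)).comp (-ContinuousLinearMap.id ℝ (Space d)) := this
    rw [h3]; simp
  have key := hhc.hasFDerivAt_convolution_right (ContinuousLinearMap.mul ℝ ℝ) hg hh1 (s • w)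
  have hl : HasDerivAt (fun s : ℝ => s • w) w s := by
    simpa using (hasDerivAt_id s).smul_const w
  have := key.comp_hasDerivAt s hl
  rw [convolution_precompR_apply _ hg (hhc.fderiv ℝ) (hh1.continuous_fderiv one_ne_zero)] at this
  convert! this using 1
  · funext s
    simp [Function.comp, convolution_def, hh]
  · simp [convolution_def, hfd, integral_neg]

lemma integral_mul_le_half_add {d : ℕ} {a b : Space d → ℝ} (ha : MemLp a 2 volume)
    (hb : MemLp b 2 volume) : ∫ x, a x * b x ≤ (∫ x, a x ^ 2) / 2 + (∫ x, b x ^ 2) / 2 := by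
  rw [← integral_div, ← integral_div, ← integral_add (ha.integrable_sq.div_const 2)
    (hb.integrable_sq.div_const 2)]
  apply integral_mono (ha.integrable_mul hb)
    ((ha.integrable_sq.div_const 2).add (hb.integrable_sq.div_const 2))
  intro x
  simp only [Pi.add_apply, Pi.mul_apply]
  nlinarith [sq_nonneg (a x - b x)]

lemma integral_comp_sub_self {d : ℕ} (f : Space d → ℝ) (w : Space d) :
    ∫ x, f (x - w) = ∫ x, f x := integral_sub_right_eq_self f w

lemma MemLp.translate {d : ℕ} {g : Space d → ℝ} (hg : MemLp g 2 volume) (w : Space d) :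
    MemLp (fun x => g (x + w)) 2 volume :=
  hg.comp_measurePreserving (measurePreserving_add_right volume w)

lemma IsH1.memLp_inner {d : ℕ} {g : Space d → ℝ} {v : Space d → Space d} (h : IsH1 g v)
    (w : Space d) : MemLp (fun x => inner ℝ (v x) w) 2 volume := by
  simpa using h.2.1.inner_const w

/-- The `L²` modulus of continuity of a Sobolev function. -/
lemma IsH1.integral_sq_translate_sub_le {d : ℕ} {g : Space d → ℝ} {v : Space d → Space d}
    (h : IsH1 g v) (w : Space d) :
    ∫ x, (g (x + w) - g x) ^ 2 ≤ ∫ x, (inner ℝ (v x) w) ^ 2 := by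
  have hgloc : LocallyIntegrable g volume := h.1.locallyIntegrable (by norm_num)
  set u : Space d → ℝ := fun x => g (x + w) - g x with hu
  have huL : MemLp u 2 volume := (MemLp.translate h.1 w).sub h.1
  have hvL := h.memLp_inner w
  -- Duality: u is tested against smooth φ, so that the translation can be put on φ, where the weak
  -- gradient is available.
  have step : ∀ φ : Space d → ℝ, ContDiff ℝ ∞ φ → HasCompactSupport φ →
      ∫ x, u x * φ x ≤ (∫ x, (inner ℝ (v x) w) ^ 2) / 2 + (∫ x, φ x ^ 2) / 2 := by
    intro φ hφ hc
    have hφL : MemLp φ 2 volume := hφ.continuous.memLp_of_hasCompactSupport hc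
    have hsh : ∀ s : ℝ, ContDiff ℝ ∞ (fun x => φ (x - s • w)) ∧
        HasCompactSupport (fun x => φ (x - s • w)) := fun s =>
      ⟨hφ.comp (contDiff_id.sub contDiff_const),
        hc.comp_homeomorph (Homeomorph.subRight (s • w))⟩
    have hder : ∀ s : ℝ, HasDerivAt (fun s : ℝ => ∫ x, g x * φ (x - s • w))
        (∫ x, φ (x - s • w) * inner ℝ (v x) w) s := by
      intro s
      have h1 := hasDerivAt_integral_mul_translate hgloc hφ hc w s
      have h2 := h.2.2 _ (hsh s).1 (hsh s).2 w
      have h3 : ∀ x, fderiv ℝ (fun x => φ (x - s • w)) x = fderiv ℝ φ (x - s • w) := fun x =>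
        by simpa [sub_eq_add_neg] using fderiv_comp_add_right (𝕜 := ℝ) (f := φ) (x := x) (-(s • w))
      simp only [h3] at h2
      rw [h2, neg_neg] at h1
      exact h1
    -- The mean value theorem on [0, 1] expresses ∫ u φ as ∫ φ(x - s • w) ⟨v, w⟩ for a single s.
    obtain ⟨s, -, hs⟩ := exists_hasDerivAt_eq_slope (fun s : ℝ => ∫ x, g x * φ (x - s • w)) _
      (zero_lt_one) (HasDerivAt.continuousOn fun x _ => hder x) (fun x _ => hder x)
    have hsL : MemLp (fun x => φ (x - s • w)) 2 volume :=
      (hsh s).1.continuous.memLp_of_hasCompactSupport (hsh s).2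
    have hb := integral_mul_le_half_add hsL hvL
    rw [hs] at hb
    have e1 : ∫ x, φ (x - s • w) ^ 2 = ∫ x, φ x ^ 2 :=
      integral_comp_sub_self (fun x => φ x ^ 2) _
    have e2 : ∫ x, g x * φ (x - (1 : ℝ) • w) = ∫ x, g (x + w) * φ x := by
      rw [← integral_comp_sub_self (fun x => g (x + w) * φ x) w]
      simp
    have e3 : ∫ x, u x * φ x = (∫ x, g (x + w) * φ x) - ∫ x, g x * φ x := by
      rw [← integral_sub]
      · simp only [hu, sub_mul]
      · exact (MemLp.translate h.1 w).integrable_mul hφL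
      · exact h.1.integrable_mul hφL
    simp only [e2, e1] at hb
    simp only [zero_smul, sub_zero, div_one] at hb
    rw [e3]; linarith
  -- Taking φ close to u in L² is optimal: ∫ u² = 2 ∫ u φ - ∫ φ² + ∫ (u - φ)², and the first two
  -- terms are bounded by `step`.
  refine le_of_forall_pos_le_add fun ε hε => ?_
  obtain ⟨φ, hc, hφ, hle⟩ := huL.exist_eLpNorm_sub_le (by norm_num) (by norm_num)
    (Real.sqrt_pos.2 hε)
  have hφL : MemLp φ 2 volume := hφ.continuous.memLp_of_hasCompactSupport hc
  have h1 := step φ hφ hc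
  have h2 : ∫ x, (u x - φ x) ^ 2 ≤ ε := by
    have h3 := (huL.sub hφL).eLpNorm_eq_integral_rpow_norm (by norm_num) (by norm_num)
    rw [h3] at hle
    have h4 := (ENNReal.ofReal_le_ofReal_iff (Real.sqrt_nonneg _)).1 hle
    simp only [ENNReal.toReal_ofNat, Pi.sub_apply, Real.rpow_ofNat, Real.norm_eq_abs, sq_abs] at h4
    rw [Real.sqrt_eq_rpow] at h4
    have := (Real.rpow_le_rpow_iff (integral_nonneg fun x => sq_nonneg _) hε.le
      (by norm_num : (0 : ℝ) < 2⁻¹)).1 (by simpa using h4)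
    exact this
  have h5 : ∫ x, (u x - φ x) ^ 2 = (∫ x, u x ^ 2) - 2 * (∫ x, u x * φ x) + ∫ x, φ x ^ 2 := by
    rw [← integral_const_mul, ← integral_sub, ← integral_add]
    · congr 1; ext x; ring
    · exact huL.integrable_sq.sub ((huL.integrable_mul hφL).const_mul 2)
    · exact hφL.integrable_sq
    · exact huL.integrable_sq
    · exact (huL.integrable_mul hφL).const_mul 2
  linarith

lemma MemLp.integrable_bdd_mul_sq {d : ℕ} {g X : Space d → ℝ} (hg : MemLp g 2 volume)
    (hX : Measurable X) {M : ℝ} (hM : ∀ x, |X x| ≤ M) :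
    Integrable (fun x => X x * g x ^ 2) volume :=
  hg.integrable_sq.bdd_mul hX.aestronglyMeasurable (ae_of_all _ hM)

/-- A discrete form of ∫ ∂ₑX g² = -2 ∫ X g ∂ₑg ≤ ‖∂ₑg‖² + ‖X g‖². Working with difference quotients
requires no regularity of X beyond boundedness and measurability; the extra terms vanish as t → 0.
-/
lemma IsH1.integral_slope_mul_sq_le {d : ℕ} {g : Space d → ℝ} {v : Space d → Space d}
    (h : IsH1 g v) {X : Space d → ℝ} (hX : Measurable X) {M : ℝ} (hM : ∀ x, |X x| ≤ M)
    (e : Space d) {t : ℝ} (ht : 0 < t) :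
    ∫ x, (X (x + t • e) - X x) / t * g x ^ 2 ≤
      (∫ x, (inner ℝ (v x) e) ^ 2) + (1 + t) * (∫ x, X x ^ 2 * g x ^ 2) +
        M ^ 2 * (t ^ 2 + t) / 4 * ∫ x, (inner ℝ (v x) e) ^ 2 := by
  have hXt : Measurable fun x => X (x + t • e) := hX.comp (measurable_add_const _)
  have i1 := MemLp.integrable_bdd_mul_sq h.1 hX hM
  have i2 := MemLp.integrable_bdd_mul_sq h.1 hXt (fun x => hM _)
  have hgt := MemLp.translate h.1 (-(t • e))
  have i3 := MemLp.integrable_bdd_mul_sq hgt hX hM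
  have i4 : Integrable (fun x => X x ^ 2 * g x ^ 2) volume :=
    MemLp.integrable_bdd_mul_sq (M := M ^ 2) h.1 (hX.pow_const 2) (fun x => by
      rw [abs_pow]; exact pow_le_pow_left₀ (abs_nonneg _) (hM x) 2)
  have i5 : Integrable (fun x => (g (x + -(t • e)) - g x) ^ 2) volume := (hgt.sub h.1).integrable_sq
  have hL := h.integral_sq_translate_sub_le (-(t • e))
  have hA : ∫ x, (inner ℝ (v x) (-(t • e))) ^ 2 = t ^ 2 * ∫ x, (inner ℝ (v x) e) ^ 2 := by
    rw [← integral_const_mul]; congr 1; ext x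
    rw [inner_neg_right, inner_smul_right]; ring
  rw [hA] at hL
  -- Summation by parts: the shift moves from X to g².
  have e1 : ∫ x, (X (x + t • e) - X x) / t * g x ^ 2 =
      ∫ x, X x * (g (x + -(t • e)) ^ 2 - g x ^ 2) / t := by
    have s1 : ∫ x, (X (x + t • e) - X x) / t * g x ^ 2 =
        ((∫ x, X (x + t • e) * g x ^ 2) - ∫ x, X x * g x ^ 2) / t := by
      rw [← integral_sub i2 i1, ← integral_div]; congr 1; ext x; ring
    have s2 : ∫ x, X x * (g (x + -(t • e)) ^ 2 - g x ^ 2) / t =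
        ((∫ x, X x * g (x + -(t • e)) ^ 2) - ∫ x, X x * g x ^ 2) / t := by
      rw [← integral_sub i3 i1, ← integral_div]; congr 1; ext x; ring
    have s3 : ∫ x, X (x + t • e) * g x ^ 2 = ∫ x, X x * g (x + -(t • e)) ^ 2 := by
      rw [← integral_comp_sub_self (fun x => X (x + t • e) * g x ^ 2) (t • e)]
      simp [sub_eq_add_neg]
    rw [s1, s2, s3]
  have hmono : ∫ x, X x * (g (x + -(t • e)) ^ 2 - g x ^ 2) / t ≤
      ∫ x, ((1 / t ^ 2 + M ^ 2 * (1 + 1 / t) / 4) * (g (x + -(t • e)) - g x) ^ 2 +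
        (1 + t) * (X x ^ 2 * g x ^ 2)) := by
    apply integral_mono
    · have := (i3.sub i1).div_const t
      refine this.congr (ae_of_all _ fun x => ?_)
      simp only [Pi.sub_apply]; ring
    · exact (i5.const_mul _).add (i4.const_mul _)
    intro x
    simp only
    set a := g x
    obtain ⟨δ, hδ⟩ : ∃ δ, g (x + -(t • e)) = a + δ := ⟨g (x + -(t • e)) - a, by ring⟩
    rw [hδ]
    have hX2 : X x ^ 2 ≤ M ^ 2 := by
      rw [← sq_abs]; exact pow_le_pow_left₀ (abs_nonneg _) (hM x) 2
    -- The difference of squares is 2δ times the midpoint a + δ/2; this is 2pq ≤ p² + q². In `h2`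
    -- the weight t is chosen because ∫ δ² = O(t²), so even the coefficient 1/t leaves an error
    -- O(t).
    have h1 : X x * ((a + δ) ^ 2 - a ^ 2) / t ≤ (δ / t) ^ 2 + X x ^ 2 * (a + δ / 2) ^ 2 := by
      have : X x * ((a + δ) ^ 2 - a ^ 2) / t = 2 * (δ / t) * (X x * (a + δ / 2)) := by
        field_simp; ring
      rw [this]
      nlinarith [sq_nonneg (δ / t - X x * (a + δ / 2))]
    have h2 : (a + δ / 2) ^ 2 ≤ (1 + t) * a ^ 2 + (1 + 1 / t) * δ ^ 2 / 4 := by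
      have h3 : (1 + t) * a ^ 2 + (1 + 1 / t) * δ ^ 2 / 4 - (a + δ / 2) ^ 2 =
          (2 * t * a - δ) ^ 2 / (4 * t) := by
        field_simp; ring
      have : 0 ≤ (2 * t * a - δ) ^ 2 / (4 * t) := by positivity
      linarith
    have h4 : X x ^ 2 * (a + δ / 2) ^ 2 ≤
        X x ^ 2 * ((1 + t) * a ^ 2) + M ^ 2 * ((1 + 1 / t) * δ ^ 2 / 4) := by
      have h5 : 0 ≤ (1 + 1 / t) * δ ^ 2 / 4 := by positivity
      calc _ ≤ X x ^ 2 * ((1 + t) * a ^ 2 + (1 + 1 / t) * δ ^ 2 / 4) :=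
            mul_le_mul_of_nonneg_left h2 (sq_nonneg _)
        _ ≤ _ := by nlinarith [mul_le_mul_of_nonneg_right hX2 h5]
    calc _ ≤ _ := h1
      _ ≤ (δ / t) ^ 2 + (X x ^ 2 * ((1 + t) * a ^ 2) + M ^ 2 * ((1 + 1 / t) * δ ^ 2 / 4)) := by
        linarith
      _ = _ := by rw [div_pow]; ring
  rw [e1]
  refine hmono.trans ?_
  rw [integral_add (i5.const_mul _) (i4.const_mul _), integral_const_mul, integral_const_mul]
  have hc : 0 ≤ 1 / t ^ 2 + M ^ 2 * (1 + 1 / t) / 4 := by positivity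
  have h6 := mul_le_mul_of_nonneg_left hL hc
  have h7 : (1 / t ^ 2 + M ^ 2 * (1 + 1 / t) / 4) * (t ^ 2 * ∫ x, (inner ℝ (v x) e) ^ 2) =
      (∫ x, (inner ℝ (v x) e) ^ 2) +
        M ^ 2 * (t ^ 2 + t) / 4 * ∫ x, (inner ℝ (v x) e) ^ 2 := by
    field_simp
  linarith

/-- For a bounded function `X`, increasing along the direction `e` and with a.e. directional
derivative `D`, one has `∫ D g² ≤ ‖∂ₑg‖² + ‖X g‖²`. -/
lemma IsH1.lintegral_deriv_mul_sq_le {d : ℕ} {g : Space d → ℝ} {v : Space d → Space d}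
    (h : IsH1 g v) {X D : Space d → ℝ} (hX : Measurable X) {M : ℝ} (hM : ∀ x, |X x| ≤ M)
    (e : Space d) (hmono : ∀ x (t : ℝ), 0 ≤ t → X x ≤ X (x + t • e))
    (hD : ∀ᵐ x : Space d, Tendsto (fun n : ℕ =>
      (X (x + (1 / ((n : ℝ) + 1)) • e) - X x) / (1 / ((n : ℝ) + 1))) atTop (𝓝 (D x))) :
    ∫⁻ x, ENNReal.ofReal (D x * g x ^ 2) ≤
      ENNReal.ofReal ((∫ x, (inner ℝ (v x) e) ^ 2) + ∫ x, X x ^ 2 * g x ^ 2) := by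
  set A := ∫ x, (inner ℝ (v x) e) ^ 2
  set B := ∫ x, X x ^ 2 * g x ^ 2
  set τ : ℕ → ℝ := fun n => 1 / ((n : ℝ) + 1) with hτ
  have hτpos : ∀ n, 0 < τ n := fun n => Nat.one_div_pos_of_nat
  have hτ0 : Tendsto τ atTop (𝓝 0) := tendsto_one_div_add_atTop_nhds_zero_nat
  set F : ℕ → Space d → ℝ≥0∞ := fun n x =>
    ENNReal.ofReal ((X (x + τ n • e) - X x) / τ n * g x ^ 2) with hF
  have hXt : ∀ n, Measurable fun x => X (x + τ n • e) := fun n =>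
    hX.comp (measurable_add_const _)
  have hFm : ∀ n, AEMeasurable (F n) volume := fun n =>
    ((((hXt n).sub hX).div_const _).aemeasurable.mul (h.1.aemeasurable.pow_const 2)).ennreal_ofReal
  have hb : ∀ n, ∫⁻ x, F n x ≤
      ENNReal.ofReal (A + (1 + τ n) * B + M ^ 2 * (τ n ^ 2 + τ n) / 4 * A) := by
    intro n
    have hi : Integrable (fun x => (X (x + τ n • e) - X x) / τ n * g x ^ 2) volume := by
      apply MemLp.integrable_bdd_mul_sq h.1 (((hXt n).sub hX).div_const _)
        (M := (M + M) / τ n)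
      intro x
      rw [abs_div, abs_of_pos (hτpos n)]
      gcongr
      exact (abs_sub (X (x + τ n • e)) (X x)).trans (add_le_add (hM _) (hM _))
    rw [← ofReal_integral_eq_lintegral_ofReal hi]
    · exact ENNReal.ofReal_le_ofReal (h.integral_slope_mul_sq_le hX hM e (hτpos n))
    · refine ae_of_all _ fun x => ?_
      have := hmono x _ (hτpos n).le
      have h2 := hτpos n
      exact mul_nonneg (div_nonneg (by linarith) h2.le) (sq_nonneg _)
  have hlim : Tendsto (fun n => ENNReal.ofReal
      (A + (1 + τ n) * B + M ^ 2 * (τ n ^ 2 + τ n) / 4 * A)) atTop (𝓝 (ENNReal.ofReal (A + B))) := by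
    apply ENNReal.tendsto_ofReal
    have hcont : Continuous fun s : ℝ => A + (1 + s) * B + M ^ 2 * (s ^ 2 + s) / 4 * A := by
      fun_prop
    have := (hcont.tendsto 0).comp hτ0
    simpa [Function.comp_def] using this
  -- Fatou's lemma: by monotonicity the slopes are nonnegative, so the a.e. derivative suffices even
  -- if X has a singular part along the line.
  calc ∫⁻ x, ENNReal.ofReal (D x * g x ^ 2) = ∫⁻ x, liminf (fun n => F n x) atTop := by
        apply lintegral_congr_ae
        filter_upwards [hD] with x hx
        exact ((ENNReal.tendsto_ofReal (hx.mul_const _)).liminf_eq).symm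
    _ ≤ liminf (fun n => ∫⁻ x, F n x) atTop := lintegral_liminf_le' hFm
    _ ≤ liminf (fun n => ENNReal.ofReal
        (A + (1 + τ n) * B + M ^ 2 * (τ n ^ 2 + τ n) / 4 * A)) atTop :=
        liminf_le_liminf (Eventually.of_forall hb)
    _ = _ := hlim.liminf_eq

/-! ### The one-dimensional Gaussian and its quantile function. -/

/-- The density of the centred normal distribution on `ℝ` with variance `1 / (2ρ)`. -/
def gaussDensity (ρ s : ℝ) : ℝ := Real.sqrt (ρ / Real.pi) * Real.exp (-ρ * s ^ 2)

/-- The distribution function belonging to `gaussDensity`. -/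
def gaussCdf (ρ t : ℝ) : ℝ := 1 / 2 + ∫ s in (0 : ℝ)..t, gaussDensity ρ s

/-- The quantile function belonging to `gaussDensity`. -/
def gaussQuantile (ρ : ℝ) : ℝ → ℝ := Function.invFun (gaussCdf ρ)

lemma gaussDensity_pos {ρ : ℝ} (hρ : 0 < ρ) (s : ℝ) : 0 < gaussDensity ρ s := by
  unfold gaussDensity
  have := Real.pi_pos
  positivity

lemma continuous_gaussDensity (ρ : ℝ) : Continuous (gaussDensity ρ) := by
  unfold gaussDensity; fun_prop

lemma log_gaussDensity {ρ : ℝ} (hρ : 0 < ρ) (s : ℝ) :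
    Real.log (gaussDensity ρ s) = 1 / 2 * Real.log (ρ / Real.pi) - ρ * s ^ 2 := by
  have h : 0 < ρ / Real.pi := div_pos hρ Real.pi_pos
  unfold gaussDensity
  rw [Real.log_mul (Real.sqrt_pos.2 h).ne' (Real.exp_pos _).ne', Real.log_exp,
    Real.log_sqrt h.le]
  ring

lemma hasDerivAt_gaussCdf (ρ t : ℝ) : HasDerivAt (gaussCdf ρ) (gaussDensity ρ t) t :=
  (intervalIntegral.integral_hasDerivAt_right
    ((continuous_gaussDensity ρ).intervalIntegrable _ _)
    ((continuous_gaussDensity ρ).stronglyMeasurableAtFilter _ _)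
    (continuous_gaussDensity ρ).continuousAt).const_add _

lemma strictMono_gaussCdf {ρ : ℝ} (hρ : 0 < ρ) : StrictMono (gaussCdf ρ) :=
  strictMono_of_hasDerivAt_pos (hasDerivAt_gaussCdf ρ) (gaussDensity_pos hρ)

lemma gaussCdf_neg (ρ t : ℝ) : gaussCdf ρ (-t) = 1 - gaussCdf ρ t := by
  have h : ∫ s in (0 : ℝ)..(-t), gaussDensity ρ s = -∫ s in (0 : ℝ)..t, gaussDensity ρ s := by
    have h1 := intervalIntegral.integral_comp_neg (a := 0) (b := t) (gaussDensity ρ)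
    have h2 : ∀ s, gaussDensity ρ (-s) = gaussDensity ρ s := fun s => by simp [gaussDensity]
    simp only [h2, neg_zero] at h1
    rw [intervalIntegral.integral_symm, ← h1]
  unfold gaussCdf; rw [h]; ring

lemma tendsto_gaussCdf_atTop {ρ : ℝ} (hρ : 0 < ρ) : Tendsto (gaussCdf ρ) atTop (𝓝 1) := by
  have hi : Integrable (gaussDensity ρ) volume := (integrable_exp_neg_mul_sq hρ).const_mul _
  have h := intervalIntegral_tendsto_integral_Ioi (μ := volume) (f := gaussDensity ρ) 0
    hi.integrableOn tendsto_id
  have hv : ∫ s in Set.Ioi (0 : ℝ), gaussDensity ρ s = 1 / 2 := by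
    unfold gaussDensity
    rw [integral_const_mul, integral_gaussian_Ioi]
    have : Real.sqrt (ρ / Real.pi) * Real.sqrt (Real.pi / ρ) = 1 := by
      have h2 := Real.pi_pos
      rw [← Real.sqrt_mul (by positivity)]
      field_simp
      simp
    linarith
  rw [hv] at h
  have := h.const_add (1 / 2)
  norm_num only at this
  exact this

lemma gaussCdf_lt_one {ρ : ℝ} (hρ : 0 < ρ) (t : ℝ) : gaussCdf ρ t < 1 :=
  (strictMono_gaussCdf hρ (lt_add_one t)).trans_le
    ((strictMono_gaussCdf hρ).monotone.ge_of_tendsto (tendsto_gaussCdf_atTop hρ) _)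

lemma range_gaussCdf {ρ : ℝ} (hρ : 0 < ρ) : Set.range (gaussCdf ρ) = Set.Ioo 0 1 := by
  ext y
  constructor
  · rintro ⟨t, rfl⟩
    have := gaussCdf_lt_one hρ (-t)
    rw [gaussCdf_neg] at this
    exact ⟨by linarith, gaussCdf_lt_one hρ t⟩
  · rintro ⟨h0, h1⟩
    have hc : Continuous (gaussCdf ρ) :=
      continuous_iff_continuousAt.2 fun t => (hasDerivAt_gaussCdf ρ t).continuousAt
    obtain ⟨b, hb⟩ := ((tendsto_gaussCdf_atTop hρ).eventually (lt_mem_nhds h1)).exists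
    obtain ⟨a, ha⟩ := ((tendsto_gaussCdf_atTop hρ).eventually
      (lt_mem_nhds (by linarith : 1 - y < 1))).exists
    refine mem_range_of_exists_le_of_exists_ge hc ⟨-a, ?_⟩ ⟨b, hb.le⟩
    rw [gaussCdf_neg]; linarith

lemma gaussCdf_gaussQuantile {ρ : ℝ} (hρ : 0 < ρ) {y : ℝ} (hy : y ∈ Set.Ioo (0 : ℝ) 1) :
    gaussCdf ρ (gaussQuantile ρ y) = y :=
  Function.invFun_eq (by rw [← range_gaussCdf hρ] at hy; exact hy)

lemma gaussQuantile_gaussCdf {ρ : ℝ} (hρ : 0 < ρ) (t : ℝ) :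
    gaussQuantile ρ (gaussCdf ρ t) = t :=
  Function.leftInverse_invFun (strictMono_gaussCdf hρ).injective t

lemma strictMonoOn_gaussQuantile {ρ : ℝ} (hρ : 0 < ρ) :
    StrictMonoOn (gaussQuantile ρ) (Set.Ioo 0 1) := by
  intro a ha b hb hab
  rw [← (strictMono_gaussCdf hρ).lt_iff_lt, gaussCdf_gaussQuantile hρ ha,
    gaussCdf_gaussQuantile hρ hb]
  exact hab

lemma hasDerivAt_gaussQuantile {ρ : ℝ} (hρ : 0 < ρ) {y : ℝ} (hy : y ∈ Set.Ioo (0 : ℝ) 1) :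
    HasDerivAt (gaussQuantile ρ) (gaussDensity ρ (gaussQuantile ρ y))⁻¹ y := by
  have hn : Set.Ioo (0 : ℝ) 1 ∈ 𝓝 y := Ioo_mem_nhds hy.1 hy.2
  refine HasDerivAt.of_local_left_inverse ?_ (hasDerivAt_gaussCdf ρ _)
    (gaussDensity_pos hρ _).ne' ?_
  · apply (strictMonoOn_gaussQuantile hρ).continuousAt_of_image_mem_nhds hn
    have : gaussQuantile ρ '' Set.Ioo 0 1 = Set.univ := by
      rw [Set.eq_univ_iff_forall]
      intro t
      exact ⟨gaussCdf ρ t, by rw [← range_gaussCdf hρ]; exact ⟨t, rfl⟩,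
        gaussQuantile_gaussCdf hρ t⟩
    rw [this]; exact univ_mem
  · filter_upwards [hn] with z hz using gaussCdf_gaussQuantile hρ hz

lemma measurable_gaussQuantile {ρ : ℝ} (hρ : 0 < ρ) : Measurable (gaussQuantile ρ) := by
  -- Off the range (0, 1) `Function.invFun` takes a fixed default value; 2 is just one point outside
  -- this range.
  have h : gaussQuantile ρ = (Set.Ioo (0 : ℝ) 1).piecewise (gaussQuantile ρ)
      (fun _ => gaussQuantile ρ 2) := by
    ext y
    by_cases hy : y ∈ Set.Ioo (0 : ℝ) 1
    · simp [Set.piecewise, hy]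
    · rw [Set.piecewise_eq_of_notMem _ _ _ hy]
      have h1 : ∀ z, z ∉ Set.Ioo (0 : ℝ) 1 → ¬ ∃ t, gaussCdf ρ t = z := by
        intro z hz
        rw [← range_gaussCdf hρ] at hz
        exact hz
      unfold gaussQuantile
      rw [Function.invFun_neg (h1 y hy), Function.invFun_neg (h1 2 (by norm_num))]
  rw [h]
  exact ContinuousOn.measurable_piecewise
    (fun y hy => (hasDerivAt_gaussQuantile hρ hy).continuousAt.continuousWithinAt)
    continuousOn_const measurableSet_Ioo

/-! ### Monotone transport along parallel lines. -/

section

/-- The integral of `p` over the line through `x` in the direction `e`. -/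
def lineMass {d : ℕ} (p : Space d → ℝ≥0∞) (e x : Space d) : ℝ≥0∞ := ∫⁻ t : ℝ, p (x + t • e)

/-- The conditional distribution function of `p` along lines in the direction `e`. -/
def lineCdf {d : ℕ} (p : Space d → ℝ≥0∞) (e x : Space d) : ℝ :=
  ((∫⁻ t in Set.Iic (0 : ℝ), p (x + t • e)) / lineMass p e x).toReal

/-- The monotone transport of `κ` times the conditional distribution of `p` along lines in the
direction `e` to the central part of mass `κ` of a normal distribution. -/
def lineTransport {d : ℕ} (ρ κ : ℝ) (p : Space d → ℝ≥0∞) (e x : Space d) : ℝ :=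
  gaussQuantile ρ ((1 - κ) / 2 + κ * lineCdf p e x)

/-- The derivative of `lineTransport` in the direction `e`. -/
def lineStretch {d : ℕ} (ρ κ : ℝ) (p : Space d → ℝ≥0∞) (e x : Space d) : ℝ :=
  κ * (p x / lineMass p e x).toReal / gaussDensity ρ (lineTransport ρ κ p e x)

/-- A property holds almost everywhere iff it holds almost everywhere on almost every line. -/
lemma ae_ae_line_iff {d : ℕ} {P : Space d → Prop} (hP : MeasurableSet {x | P x}) (e : Space d) :
    (∀ᵐ x : Space d, ∀ᵐ t : ℝ, P (x + t • e)) ↔ ∀ᵐ x : Space d, P x := by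
  rw [Measure.ae_ae_comm (p := fun (x : Space d) (t : ℝ) => P (x + t • e))]
  · have h : ∀ t : ℝ, (∀ᵐ x : Space d, P (x + t • e)) ↔ ∀ᵐ x : Space d, P x := fun t =>
      ⟨fun h => by
        have := (measurePreserving_add_right (volume : Measure (Space d))
          (-(t • e))).quasiMeasurePreserving.ae h
        simpa using this,
      fun h => (measurePreserving_add_right (volume : Measure (Space d))
          (t • e)).quasiMeasurePreserving.ae h⟩
    simp only [h]
    simp
  · have : Measurable fun q : Space d × ℝ => q.1 + q.2 • e := by fun_prop
    exact this hP

variable {d : ℕ} {p : Space d → ℝ≥0∞}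

lemma measurable_line (hp : Measurable p) (e x : Space d) :
    Measurable fun t : ℝ => p (x + t • e) := hp.comp (by fun_prop)

lemma measurable_lineMass (hp : Measurable p) (e : Space d) : Measurable (lineMass p e) := by
  have : Measurable fun q : Space d × ℝ => p (q.1 + q.2 • e) := hp.comp (by fun_prop)
  exact this.lintegral_prod_right'

lemma measurable_lineCdf (hp : Measurable p) (e : Space d) : Measurable (lineCdf p e) := by
  have : Measurable fun q : Space d × ℝ => p (q.1 + q.2 • e) := hp.comp (by fun_prop)
  exact (this.lintegral_prod_right'.div (measurable_lineMass hp e)).ennreal_toReal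

lemma lineMass_add_smul (e x : Space d) (s : ℝ) : lineMass p e (x + s • e) = lineMass p e x := by
  unfold lineMass
  rw [← lintegral_add_left_eq_self (μ := volume) (fun t : ℝ => p (x + t • e)) s]
  simp only [add_smul, add_assoc]

lemma setLIntegral_Iic_comp_add (h : ℝ → ℝ≥0∞) (s : ℝ) :
    ∫⁻ t in Set.Iic (0 : ℝ), h (s + t) = ∫⁻ t in Set.Iic s, h t := by
  rw [← lintegral_indicator measurableSet_Iic, ← lintegral_indicator measurableSet_Iic,
    ← lintegral_add_left_eq_self (μ := volume) ((Set.Iic s).indicator h) s]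
  congr 1; ext t
  simp [Set.indicator]

lemma lineCdf_add_smul (e x : Space d) (s : ℝ) : lineCdf p e (x + s • e) =
    ((∫⁻ t in Set.Iic s, p (x + t • e)) / lineMass p e x).toReal := by
  unfold lineCdf
  rw [lineMass_add_smul, ← setLIntegral_Iic_comp_add (fun t => p (x + t • e))]
  simp only [add_smul, add_assoc]

lemma lineCdf_mem_Icc (e x : Space d) : lineCdf p e x ∈ Set.Icc (0 : ℝ) 1 :=
  ⟨ENNReal.toReal_nonneg, ENNReal.toReal_le_of_le_ofReal zero_le_one (by
    rw [ENNReal.ofReal_one]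
    exact ENNReal.div_le_of_le_mul (by rw [one_mul]; exact setLIntegral_le_lintegral _ _))⟩

lemma lineCdf_mono (e x : Space d) {t : ℝ} (ht : 0 ≤ t) :
    lineCdf p e x ≤ lineCdf p e (x + t • e) := by
  have h0 := lineCdf_add_smul (p := p) e x 0
  simp only [zero_smul, add_zero] at h0
  rw [h0, lineCdf_add_smul]
  have hle : (∫⁻ t in Set.Iic t, p (x + t • e)) / lineMass p e x ≤ 1 :=
    ENNReal.div_le_of_le_mul (by rw [one_mul]; exact setLIntegral_le_lintegral _ _)
  apply ENNReal.toReal_mono (ne_top_of_le_ne_top ENNReal.one_ne_top hle)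
  gcongr

/-- Cutting off mass (1 - κ)/2 at both ends keeps the argument of the quantile function in a compact
part of (0, 1); hence the transport is bounded. -/
lemma shrink_mem {κ : ℝ} (h0 : 0 < κ) (h1 : κ < 1) {y : ℝ} (hy : y ∈ Set.Icc (0 : ℝ) 1) :
    (1 - κ) / 2 + κ * y ∈ Set.Icc ((1 - κ) / 2) ((1 + κ) / 2) ∧
    (1 - κ) / 2 + κ * y ∈ Set.Ioo (0 : ℝ) 1 := by
  obtain ⟨a, b⟩ := hy
  refine ⟨⟨?_, ?_⟩, ?_, ?_⟩ <;> nlinarith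

lemma measurable_lineTransport {ρ κ : ℝ} (hρ : 0 < ρ) (hp : Measurable p) (e : Space d) :
    Measurable (lineTransport ρ κ p e) :=
  (measurable_gaussQuantile hρ).comp (((measurable_lineCdf hp e).const_mul _).const_add _)

lemma measurable_lineStretch {ρ κ : ℝ} (hρ : 0 < ρ) (hp : Measurable p) (e : Space d) :
    Measurable (lineStretch ρ κ p e) :=
  ((hp.div (measurable_lineMass hp e)).ennreal_toReal.const_mul _).div
    ((continuous_gaussDensity ρ).measurable.comp (measurable_lineTransport hρ hp e))

lemma lineStretch_nonneg {ρ κ : ℝ} (hρ : 0 < ρ) (h0 : 0 < κ) (e x : Space d) :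
    0 ≤ lineStretch ρ κ p e x :=
  div_nonneg (mul_nonneg h0.le ENNReal.toReal_nonneg) (gaussDensity_pos hρ _).le

lemma exists_abs_lineTransport_le {ρ κ : ℝ} (hρ : 0 < ρ) (h0 : 0 < κ) (h1 : κ < 1)
    (p : Space d → ℝ≥0∞) (e : Space d) : ∃ M, ∀ x, |lineTransport ρ κ p e x| ≤ M := by
  have hm := strictMonoOn_gaussQuantile hρ
  have ha : (1 - κ) / 2 ∈ Set.Ioo (0 : ℝ) 1 := ⟨by linarith, by linarith⟩
  have hb : (1 + κ) / 2 ∈ Set.Ioo (0 : ℝ) 1 := ⟨by linarith, by linarith⟩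
  refine ⟨max |gaussQuantile ρ ((1 - κ) / 2)| |gaussQuantile ρ ((1 + κ) / 2)|, fun x => ?_⟩
  obtain ⟨⟨hl, hu⟩, hi⟩ := shrink_mem h0 h1 (lineCdf_mem_Icc (p := p) e x)
  exact abs_le_max_abs_abs (hm.monotoneOn ha hi hl) (hm.monotoneOn hi hb hu)

lemma lineTransport_mono {ρ κ : ℝ} (hρ : 0 < ρ) (h0 : 0 < κ) (h1 : κ < 1) (e x : Space d)
    {t : ℝ} (ht : 0 ≤ t) : lineTransport ρ κ p e x ≤ lineTransport ρ κ p e (x + t • e) := by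
  apply (strictMonoOn_gaussQuantile hρ).monotoneOn (shrink_mem h0 h1 (lineCdf_mem_Icc _ _)).2
    (shrink_mem h0 h1 (lineCdf_mem_Icc _ _)).2
  have := lineCdf_mono (p := p) e x ht
  gcongr

lemma lineMass_ne_zero (hp : Measurable p) (hpos : ∀ x, p x ≠ 0) (e x : Space d) :
    lineMass p e x ≠ 0 := by
  unfold lineMass
  rw [Ne, lintegral_eq_zero_iff (measurable_line hp e x)]
  intro h
  have h2 : ∀ᵐ t : ℝ, False := by
    filter_upwards [h] with t ht using hpos _ ht
  simp at h2
  exact NeZero.ne _ h2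

lemma integrable_line (hp : Measurable p) {e x : Space d} (h0 : lineMass p e x ≠ 0)
    (h1 : lineMass p e x ≠ ⊤) :
    Integrable (fun t : ℝ => (p (x + t • e) / lineMass p e x).toReal) volume := by
  apply integrable_toReal_of_lintegral_ne_top
  · exact ((measurable_line hp e x).div_const _).aemeasurable
  · simp only [div_eq_mul_inv]
    rw [lintegral_mul_const _ (measurable_line hp e x)]
    exact ENNReal.mul_ne_top h1 (ENNReal.inv_ne_top.2 h0)

lemma ae_line_ne_top (hp : Measurable p) {e x : Space d} (h1 : lineMass p e x ≠ ⊤) :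
    ∀ᵐ t : ℝ, p (x + t • e) ≠ ⊤ := by
  filter_upwards [ae_lt_top (measurable_line hp e x) h1] with t ht using ht.ne

lemma lineCdf_add_smul_eq_integral (hp : Measurable p) {e x : Space d}
    (h0 : lineMass p e x ≠ 0) (h1 : lineMass p e x ≠ ⊤) (s : ℝ) :
    lineCdf p e (x + s • e) = lineCdf p e x +
      ∫ t in (0 : ℝ)..s, (p (x + t • e) / lineMass p e x).toReal := by
  have key : ∀ s : ℝ, lineCdf p e (x + s • e) =
      ∫ t in Set.Iic s, (p (x + t • e) / lineMass p e x).toReal := by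
    intro s
    rw [lineCdf_add_smul, integral_toReal]
    · simp only [div_eq_mul_inv]
      rw [lintegral_mul_const _ (measurable_line hp e x)]
    · exact ((measurable_line hp e x).div_const _).aemeasurable
    · refine ae_restrict_of_ae ?_
      filter_upwards [ae_line_ne_top hp h1] with t ht
      exact ENNReal.div_lt_top ht h0
  have h := key 0
  simp only [zero_smul, add_zero] at h
  have hi := integrable_line hp h0 h1
  rw [key s, h, ← intervalIntegral.integral_Iic_sub_Iic hi.integrableOn hi.integrableOn]
  ring

lemma hasDerivAt_lineTransport {ρ κ : ℝ} (hρ : 0 < ρ) {e x : Space d} {s : ℝ}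
    (hmem : (1 - κ) / 2 + κ * lineCdf p e (x + s • e) ∈ Set.Ioo (0 : ℝ) 1)
    (h : HasDerivAt (fun s : ℝ => lineCdf p e (x + s • e))
      (p (x + s • e) / lineMass p e x).toReal s) :
    HasDerivAt (fun s : ℝ => lineTransport ρ κ p e (x + s • e))
      (lineStretch ρ κ p e (x + s • e)) s := by
  have h2 := (h.const_mul κ).const_add ((1 - κ) / 2)
  have h3 := (hasDerivAt_gaussQuantile hρ hmem).comp s h2
  convert! h3 using 1
  rw [lineStretch, lineMass_add_smul, lineTransport, div_eq_inv_mul]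

/-- Lebesgue differentiation of the distribution function on almost every line, combined with the
chain rule for the quantile function and transferred to almost every point by `ae_ae_line_iff`. -/
lemma tendsto_lineTransport_slope {ρ κ : ℝ} (hρ : 0 < ρ) (h0 : 0 < κ) (h1 : κ < 1)
    (hp : Measurable p) (hpos : ∀ x, p x ≠ 0) (e : Space d)
    (hfin : ∀ᵐ x : Space d, lineMass p e x ≠ ⊤) :
    ∀ᵐ x : Space d, Tendsto (fun n : ℕ =>
      (lineTransport ρ κ p e (x + (1 / ((n : ℝ) + 1)) • e) - lineTransport ρ κ p e x) /
        (1 / ((n : ℝ) + 1))) atTop (𝓝 (lineStretch ρ κ p e x)) := by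
  have hT := measurable_lineTransport (κ := κ) hρ hp e
  rw [← ae_ae_line_iff _ e]
  · filter_upwards [hfin] with x hx
    have hi := integrable_line hp (lineMass_ne_zero hp hpos e x) hx
    filter_upwards [_root_.LocallyIntegrable.ae_hasDerivAt_integral hi.locallyIntegrable] with s hs
    have h2 : HasDerivAt (fun s : ℝ => lineCdf p e (x + s • e))
        (p (x + s • e) / lineMass p e x).toReal s := by
      have := (hs 0).const_add (lineCdf p e x)
      exact this.congr_of_eventuallyEq (Eventually.of_forall fun s =>
        lineCdf_add_smul_eq_integral hp (lineMass_ne_zero hp hpos e x) hx s)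
    have h3 := (hasDerivAt_lineTransport hρ
      (shrink_mem h0 h1 (lineCdf_mem_Icc e _)).2 h2).tendsto_slope_zero_right
    have h4 : Tendsto (fun n : ℕ => 1 / ((n : ℝ) + 1)) atTop (𝓝[>] 0) :=
      tendsto_nhdsWithin_iff.2 ⟨tendsto_one_div_add_atTop_nhds_zero_nat,
        Eventually.of_forall fun n => Set.mem_Ioi.2 Nat.one_div_pos_of_nat⟩
    refine (h3.comp h4).congr fun n => ?_
    simp only [Function.comp, smul_eq_mul, add_smul, ← add_assoc]
    rw [inv_mul_eq_div]
  · exact measurableSet_tendsto_fun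
      (fun n => ((hT.comp (measurable_add_const _)).sub hT).div_const _)
      (measurable_lineStretch hρ hp e)

/-- The integration by parts bound for X = ρ T. This scaling makes the quadratic term match the
Gaussian exponent ρ T² after multiplication by ρ. -/
lemma lineStretch_integral_le {ρ κ : ℝ} (hρ : 0 < ρ) (h0 : 0 < κ) (h1 : κ < 1)
    (hp : Measurable p) (hpos : ∀ x, p x ≠ 0) (e : Space d)
    (hfin : ∀ᵐ x : Space d, lineMass p e x ≠ ⊤)
    {g : Space d → ℝ} {v : Space d → Space d} (h : IsH1 g v) :
    Integrable (fun x => ρ * lineStretch ρ κ p e x * g x ^ 2) volume ∧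
    Integrable (fun x => (ρ * lineTransport ρ κ p e x) ^ 2 * g x ^ 2) volume ∧
    ∫ x, ρ * lineStretch ρ κ p e x * g x ^ 2 ≤
      (∫ x, (inner ℝ (v x) e) ^ 2) + ∫ x, (ρ * lineTransport ρ κ p e x) ^ 2 * g x ^ 2 := by
  have hT := measurable_lineTransport (κ := κ) hρ hp e
  obtain ⟨M, hM⟩ := exists_abs_lineTransport_le hρ h0 h1 p e
  have hM' : ∀ x, |ρ * lineTransport ρ κ p e x| ≤ ρ * M := fun x => by
    rw [abs_mul, abs_of_pos hρ]; exact mul_le_mul_of_nonneg_left (hM x) hρ.le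
  have key := h.lintegral_deriv_mul_sq_le (X := fun x => ρ * lineTransport ρ κ p e x)
    (D := fun x => ρ * lineStretch ρ κ p e x) (hT.const_mul ρ) hM' e
    (fun x t ht => mul_le_mul_of_nonneg_left (lineTransport_mono hρ h0 h1 e x ht) hρ.le) (by
      filter_upwards [tendsto_lineTransport_slope hρ h0 h1 hp hpos e hfin] with x hx
      refine (hx.const_mul ρ).congr fun n => ?_
      rw [← mul_sub, mul_div_assoc])
  have hnn : ∀ x, 0 ≤ ρ * lineStretch ρ κ p e x * g x ^ 2 := fun x =>
    mul_nonneg (mul_nonneg hρ.le (lineStretch_nonneg hρ h0 e x)) (sq_nonneg _)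
  have hmeas : AEStronglyMeasurable (fun x => ρ * lineStretch ρ κ p e x * g x ^ 2) volume :=
    (((measurable_lineStretch hρ hp e).const_mul ρ).aemeasurable.mul
      (h.1.aemeasurable.pow_const 2)).aestronglyMeasurable
  have hint : Integrable (fun x => ρ * lineStretch ρ κ p e x * g x ^ 2) volume := by
    refine ⟨hmeas, ?_⟩
    rw [hasFiniteIntegral_iff_ofReal (ae_of_all _ hnn)]
    exact key.trans_lt ENNReal.ofReal_lt_top
  refine ⟨hint, ?_, ?_⟩
  · exact MemLp.integrable_bdd_mul_sq (M := (ρ * M) ^ 2) h.1 ((hT.const_mul ρ).pow_const 2)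
      fun x => by rw [abs_pow]; exact pow_le_pow_left₀ (abs_nonneg _) (hM' x) 2
  · rw [← ofReal_integral_eq_lintegral_ofReal hint (ae_of_all _ hnn)] at key
    exact (ENNReal.ofReal_le_ofReal_iff (add_nonneg (integral_nonneg fun x => sq_nonneg _)
      (integral_nonneg fun x => mul_nonneg (sq_nonneg _) (sq_nonneg _)))).1 key

/-- The logarithm of the change of variables formula: κ times the conditional density along the line
equals the Gaussian density at T times the stretch. -/
lemma log_lineStretch {ρ κ : ℝ} (hρ : 0 < ρ) (h0 : 0 < κ) {e x : Space d}
    (hp0 : p x ≠ 0) (hp1 : p x ≠ ⊤) (hq0 : lineMass p e x ≠ 0) (hq1 : lineMass p e x ≠ ⊤) :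
    0 < lineStretch ρ κ p e x ∧
    Real.log (lineStretch ρ κ p e x) = Real.log κ + Real.log (p x).toReal -
      Real.log (lineMass p e x).toReal - 1 / 2 * Real.log (ρ / Real.pi) +
      ρ * lineTransport ρ κ p e x ^ 2 := by
  have a := ENNReal.toReal_pos hp0 hp1
  have b := ENNReal.toReal_pos hq0 hq1
  have c := gaussDensity_pos hρ (lineTransport ρ κ p e x)
  unfold lineStretch
  rw [ENNReal.toReal_div]
  refine ⟨by positivity, ?_⟩
  rw [Real.log_div (by positivity) c.ne', Real.log_mul h0.ne' (by positivity),
    Real.log_div a.ne' b.ne', log_gaussDensity hρ]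
  ring

end

/-! ### Iterated marginals, the Knothe map and the dual logarithmic Sobolev inequality. -/

section

/-- The integral of `f` over all coordinates with index at least `k`. -/
def partialMarginal {d : ℕ} (f : Space d → ℝ≥0∞) (k : ℕ) (x : Space d) : ℝ≥0∞ :=
  lmarginal (fun _ : Fin d => volume) (Finset.univ.filter fun j : Fin d => k ≤ j.val)
    (fun y => f (WithLp.toLp 2 y)) x.ofLp

/-- The `i`-th standard unit vector. -/
abbrev unitVec {d : ℕ} (i : Fin d) : Space d := EuclideanSpace.single i 1

/-- The common value of `χ(ρ)` and of minus the top of the spectrum for a Gaussian. -/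
def chiValue (d : ℕ) (ρ : ℝ) : ℝ := ρ * d - ρ * ((d : ℝ) / 2) * Real.log (ρ / Real.pi)

variable {d : ℕ} {f : Space d → ℝ≥0∞}

lemma measurable_partialMarginal (hf : Measurable f) (k : ℕ) :
    Measurable (partialMarginal f k) :=
  (Measurable.lmarginal _ (hf.comp (PiLp.volume_preserving_toLp (Fin d)).measurable)).comp
    (PiLp.volume_preserving_ofLp (Fin d)).measurable

lemma partialMarginal_dim (f : Space d → ℝ≥0∞) : partialMarginal f d = f := by
  ext x
  have : (Finset.univ.filter fun j : Fin d => d ≤ j.val) = ∅ := by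
    ext j; simp
  simp [partialMarginal, this]

lemma partialMarginal_zero (f : Space d → ℝ≥0∞) (x : Space d) :
    partialMarginal f 0 x = ∫⁻ y, f y := by
  simp only [partialMarginal, Nat.zero_le, Finset.filter_true, lmarginal_univ]
  exact (PiLp.volume_preserving_toLp (Fin d)).lintegral_comp_emb
    (MeasurableEquiv.toLp 2 (Fin d → ℝ)).measurableEmbedding f

/-- Integrating out one more coordinate is a line integral in that direction. Thus successive
marginals have the conditional densities as quotients, and their logarithms telescope. -/
lemma partialMarginal_eq_lineMass (hf : Measurable f) (i : Fin d) (x : Space d) :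
    partialMarginal f i.val x = lineMass (partialMarginal f (i.val + 1)) (unitVec i) x := by
  have hs : (Finset.univ.filter fun j : Fin d => i.val ≤ j.val) =
      insert i (Finset.univ.filter fun j : Fin d => i.val + 1 ≤ j.val) := by
    ext j
    simp only [Finset.mem_filter, Finset.mem_univ, true_and, Finset.mem_insert, Fin.ext_iff]
    omega
  have hm : Measurable fun y : Fin d → ℝ => f (WithLp.toLp 2 y) :=
    hf.comp (PiLp.volume_preserving_toLp (Fin d)).measurable
  rw [partialMarginal, hs, lmarginal_insert _ hm (by simp), lineMass,
    ← lintegral_add_right_eq_self (μ := volume) _ (x i)]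
  congr 1; ext t
  unfold partialMarginal
  congr 1
  ext j
  by_cases h : j = i
  · subst h; simp [add_comm]
  · simp [h]

lemma partialMarginal_ne_zero (hf : Measurable f) (hpos : ∀ x, f x ≠ 0) {k : ℕ} (hk : k ≤ d)
    (x : Space d) : partialMarginal f k x ≠ 0 := by
  induction hk using Nat.decreasingInduction generalizing x with
  | self => rw [partialMarginal_dim]; exact hpos x
  | of_succ k hk ih =>
    have := partialMarginal_eq_lineMass hf ⟨k, hk⟩ x
    simp only at this
    rw [this]
    exact lineMass_ne_zero (measurable_partialMarginal hf _) ih _ _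

lemma ae_ne_top_of_lineMass_ne_top (hf : Measurable f) {e : Space d}
    (h : ∀ᵐ x : Space d, lineMass f e x ≠ ⊤) : ∀ᵐ x : Space d, f x ≠ ⊤ := by
  rw [← ae_ae_line_iff (P := fun x => f x ≠ ⊤) (hf (measurableSet_singleton ⊤).compl) e]
  filter_upwards [h] with x hx using ae_line_ne_top hf hx

lemma partialMarginal_ne_top (hf : Measurable f) (hfin : ∫⁻ y, f y ≠ ⊤) {k : ℕ} (hk : k ≤ d) :
    ∀ᵐ x : Space d, partialMarginal f k x ≠ ⊤ := by
  induction k with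
  | zero => exact ae_of_all _ fun x => by rwa [partialMarginal_zero]
  | succ k ih =>
    apply ae_ne_top_of_lineMass_ne_top (measurable_partialMarginal hf _)
      (e := unitVec ⟨k, hk⟩)
    filter_upwards [ih (by omega)] with x hx
    rwa [← partialMarginal_eq_lineMass hf ⟨k, hk⟩ x]

/-- The logarithmic Sobolev inequality in dual form, with a remainder term. -/
theorem IsH1.exists_log_bound {ρ κ : ℝ} (hρ : 0 < ρ) (h0 : 0 < κ) (h1 : κ < 1)
    {F : Space d → ℝ} (hF : Measurable F) (hpos : ∀ x, 0 < F x)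
    (hfin : ∫⁻ x, ENNReal.ofReal (F x) ≠ ⊤) (i : Fin d) (hi : i.val + 1 = d)
    {g : Space d → ℝ} {v : Space d → Space d} (h : IsH1 g v) (hg : ∫ x, g x ^ 2 = 1) :
    ∃ U : Space d → ℝ, Integrable U volume ∧
      (∀ᵐ x : Space d, ρ * Real.log (F x) * g x ^ 2 +
        ρ * (lineStretch ρ κ (fun x => ENNReal.ofReal (F x)) (unitVec i) x - 1 -
          Real.log (lineStretch ρ κ (fun x => ENNReal.ofReal (F x)) (unitVec i) x)) * g x ^ 2 ≤
        U x) ∧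
      ∫ x, U x ≤ (∫ x, ‖v x‖ ^ 2) + ρ * Real.log (∫⁻ x, ENNReal.ofReal (F x)).toReal -
        chiValue d ρ - d * ρ * Real.log κ := by
  set p : Space d → ℝ≥0∞ := fun x => ENNReal.ofReal (F x) with hpdef
  have hp : Measurable p := hF.ennreal_ofReal
  have hp0 : ∀ x, p x ≠ 0 := fun x => by simpa [hpdef] using hpos x
  set Z := (∫⁻ x, p x).toReal with hZ
  set P : Fin d → Space d → ℝ≥0∞ := fun j => partialMarginal p (j.val + 1) with hP
  have hPm : ∀ j, Measurable (P j) := fun j => measurable_partialMarginal hp _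
  have hP0 : ∀ j x, P j x ≠ 0 := fun j x => partialMarginal_ne_zero hp hp0 j.2 x
  have hPt : ∀ j, ∀ᵐ x : Space d, P j x ≠ ⊤ := fun j => partialMarginal_ne_top hp hfin j.2
  have hQt : ∀ j, ∀ᵐ x : Space d, lineMass (P j) (unitVec j) x ≠ ⊤ := fun j => by
    filter_upwards [partialMarginal_ne_top hp hfin j.2.le] with x hx
    rwa [← partialMarginal_eq_lineMass hp j x]
  -- In the last coordinate nothing is integrated out, so this stretch is computed from F itself;
  -- this is why the remainder is recorded for i only.
  have hPi : P i = p := by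
    simp only [hP, hi]; exact partialMarginal_dim p
  set D : Fin d → Space d → ℝ := fun j => lineStretch ρ κ (P j) (unitVec j) with hD
  set T : Fin d → Space d → ℝ := fun j => lineTransport ρ κ (P j) (unitVec j) with hT
  have hDi : D i = lineStretch ρ κ p (unitVec i) := by simp only [hD, hPi]
  have hstep := fun j => lineStretch_integral_le hρ h0 h1 (hPm j) (hP0 j) (unitVec j) (hQt j) h
  set K : ℝ := ρ * Real.log Z - chiValue d ρ - d * ρ * Real.log κ with hK
  have hinner : ∀ j x, inner ℝ (v x) (unitVec j) = v x j := fun j x => by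
    simp [unitVec, EuclideanSpace.inner_single_right]
  refine ⟨fun x => K * g x ^ 2 + ∑ j, (ρ * D j x * g x ^ 2 - (ρ * T j x) ^ 2 * g x ^ 2),
    ?_, ?_, ?_⟩
  · exact (h.1.integrable_sq.const_mul K).add
      (integrable_finsetSum _ fun j _ => (hstep j).1.sub (hstep j).2.1)
  · filter_upwards [ae_all_iff.2 hPt, ae_all_iff.2 hQt] with x hx1 hx2
    rw [← hDi]
    have hlog := fun j => log_lineStretch hρ h0 (hP0 j x) (hx1 j)
      (lineMass_ne_zero (hPm j) (hP0 j) (unitVec j) x) (hx2 j)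
    -- F/Z is the product of its conditional densities: the marginals run from the total mass (k =
    -- 0) to F (k = d).
    have htel : ∑ j : Fin d, (Real.log (P j x).toReal -
        Real.log (lineMass (P j) (unitVec j) x).toReal) = Real.log (F x) - Real.log Z := by
      have e1 : ∀ j : Fin d, Real.log (P j x).toReal -
          Real.log (lineMass (P j) (unitVec j) x).toReal =
          (fun k : ℕ => Real.log (partialMarginal p (k + 1) x).toReal -
            Real.log (partialMarginal p k x).toReal) j.val := fun j => by
        simp only [hP, ← partialMarginal_eq_lineMass hp j x]
      rw [Finset.sum_congr rfl fun j _ => e1 j, Fin.sum_univ_eq_sum_range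
        (fun k : ℕ => Real.log (partialMarginal p (k + 1) x).toReal -
            Real.log (partialMarginal p k x).toReal) d,
        Finset.sum_range_sub (fun k => Real.log (partialMarginal p k x).toReal),
        partialMarginal_dim, partialMarginal_zero]
      simp [hpdef, (hpos x).le, hZ]
    have hterm : ∀ j, ρ * (Real.log (P j x).toReal -
        Real.log (lineMass (P j) (unitVec j) x).toReal) = ρ * Real.log (D j x) -
        ρ * Real.log κ + ρ / 2 * Real.log (ρ / Real.pi) - (ρ * T j x) ^ 2 := fun j => by
      rw [(hlog j).2]; ring
    have hle : ∀ j, ρ * Real.log (D j x) ≤ ρ * D j x - ρ := fun j => by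
      have := Real.log_le_sub_one_of_pos (hlog j).1
      nlinarith
    -- For j ≠ i the bound log D ≤ D - 1 is used; for j = i the loss is added back and equality
    -- holds.
    have hsum : ∑ j, (ρ * Real.log (D j x) + if j = i then ρ * (D i x - 1 - Real.log (D i x))
        else 0) ≤ ∑ j, (ρ * D j x - ρ) := by
      apply Finset.sum_le_sum
      intro j _
      split_ifs with hj
      · subst hj; linarith
      · linarith [hle j]
    rw [Finset.sum_add_distrib, Finset.sum_ite_eq' Finset.univ i, if_pos (Finset.mem_univ _)]
      at hsum
    have htel2 : ρ * Real.log (F x) - ρ * Real.log Z = (∑ j, ρ * Real.log (D j x)) -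
        d * (ρ * Real.log κ) + d * (ρ / 2 * Real.log (ρ / Real.pi)) - ∑ j, (ρ * T j x) ^ 2 := by
      rw [← mul_sub, ← htel, Finset.mul_sum, Finset.sum_congr rfl fun j _ => hterm j]
      simp [Finset.sum_sub_distrib, Finset.sum_add_distrib]
    have hfin2 : ρ * Real.log (F x) + ρ * (D i x - 1 - Real.log (D i x)) ≤
        K + ∑ j, (ρ * D j x - (ρ * T j x) ^ 2) := by
      rw [Finset.sum_sub_distrib] at hsum ⊢
      simp only [Finset.sum_const, Finset.card_univ, Fintype.card_fin, nsmul_eq_mul] at hsum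
      simp only [hK, chiValue]
      linarith
    calc _ = (ρ * Real.log (F x) + ρ * (D i x - 1 - Real.log (D i x))) * g x ^ 2 := by ring
      _ ≤ (K + ∑ j, (ρ * D j x - (ρ * T j x) ^ 2)) * g x ^ 2 :=
        mul_le_mul_of_nonneg_right hfin2 (sq_nonneg _)
      _ = _ := by rw [add_mul, Finset.sum_mul]; simp only [sub_mul]
  · have hjint : ∀ j, Integrable (fun x => ρ * D j x * g x ^ 2 - (ρ * T j x) ^ 2 * g x ^ 2)
        volume := fun j => (hstep j).1.sub (hstep j).2.1
    rw [integral_add (h.1.integrable_sq.const_mul K) (integrable_finsetSum _ fun j _ => hjint j),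
      integral_const_mul, hg, integral_finsetSum _ fun j _ => hjint j]
    have hv : ∫ x, ‖v x‖ ^ 2 = ∑ j, ∫ x, (inner ℝ (v x) (unitVec j)) ^ 2 := by
      rw [← integral_finsetSum _ fun j _ => (h.memLp_inner (unitVec j)).integrable_sq]
      congr 1; ext x
      rw [EuclideanSpace.norm_sq_eq]
      simp [hinner]
    have hle : ∑ j, ∫ x, (ρ * D j x * g x ^ 2 - (ρ * T j x) ^ 2 * g x ^ 2) ≤
        ∑ j, ∫ x, (inner ℝ (v x) (unitVec j)) ^ 2 := by
      apply Finset.sum_le_sum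
      intro j _
      rw [integral_sub (hstep j).1 (hstep j).2.1]
      linarith [(hstep j).2.2]
    rw [hv]
    simp only [hK]
    linarith

end

/-! ### Upper bound for the top of the spectrum and lower bound for χ. -/

section

variable {d : ℕ}

lemma extIntegral_eq_integral {f : Space d → ℝ} (hf : Integrable f volume) :
    extIntegral f = ((∫ x, f x : ℝ) : EReal) := by
  have h1 : ∫⁻ x, ENNReal.ofReal (f x) ≠ ⊤ := hf.lintegral_lt_top.ne
  have h2 : ∫⁻ x, ENNReal.ofReal (-f x) ≠ ⊤ := hf.neg.lintegral_lt_top.ne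
  rw [integral_eq_lintegral_pos_part_sub_lintegral_neg_part hf, EReal.coe_sub, extIntegral,
    EReal.coe_ennreal_toReal h1, EReal.coe_ennreal_toReal h2]

lemma extIntegral_mono_ae {f h : Space d → ℝ} (hle : ∀ᵐ x : Space d, f x ≤ h x) :
    extIntegral f ≤ extIntegral h := by
  apply EReal.sub_le_sub
  · exact_mod_cast lintegral_mono_ae (hle.mono fun x hx => ENNReal.ofReal_le_ofReal hx)
  · exact_mod_cast lintegral_mono_ae (hle.mono fun x hx =>
      ENNReal.ofReal_le_ofReal (neg_le_neg hx))

lemma quasiIntegrable_of_integrable {f : Space d → ℝ} (hf : Integrable f volume) :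
    QuasiIntegrable f := Or.inl hf.lintegral_lt_top.ne

lemma extIntegral_le_of_ae_le {f U : Space d → ℝ} (hU : Integrable U volume)
    (hle : ∀ᵐ x : Space d, f x ≤ U x) : extIntegral f ≤ ((∫ x, U x : ℝ) : EReal) :=
  (extIntegral_mono_ae hle).trans (extIntegral_eq_integral hU).le

lemma integral_sq_eq_one {g : Space d → ℝ} (hg : MemLp g 2 volume)
    (h : eLpNorm g 2 volume = 1) : ∫ x, g x ^ 2 = 1 := by
  rw [hg.eLpNorm_eq_integral_rpow_norm (by norm_num) (by norm_num), ENNReal.ofReal_eq_one] at h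
  simp only [ENNReal.toReal_ofNat, Real.rpow_ofNat, Real.norm_eq_abs, sq_abs] at h
  have h0 : 0 ≤ ∫ x, g x ^ 2 := integral_nonneg fun x => sq_nonneg _
  have := congrArg (fun y : ℝ => y ^ (2 : ℝ)) h
  simp only [Real.one_rpow] at this
  rwa [← Real.rpow_mul h0, inv_mul_cancel₀ (by norm_num), Real.rpow_one] at this

lemma eLpNorm_eq_one {g : Space d → ℝ} (hg : MemLp g 2 volume)
    (h : ∫ x, g x ^ 2 = 1) : eLpNorm g 2 volume = 1 := by
  rw [hg.eLpNorm_eq_integral_rpow_norm (by norm_num) (by norm_num), ENNReal.ofReal_eq_one]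
  simp [h]

lemma ae_lineMass_ne_top {f : Space d → ℝ≥0∞} (hf : Measurable f) (hfin : ∫⁻ y, f y ≠ ⊤)
    {i : Fin d} (hi : i.val + 1 = d) : ∀ᵐ x : Space d, lineMass f (unitVec i) x ≠ ⊤ := by
  filter_upwards [partialMarginal_ne_top hf hfin i.2.le] with x hx
  rwa [partialMarginal_eq_lineMass hf i x, hi, partialMarginal_dim] at hx

lemma ae_lineStretch_remainder_nonneg {ρ κ : ℝ} (hρ : 0 < ρ) (h0 : 0 < κ)
    {F : Space d → ℝ} (hF : Measurable F) (hpos : ∀ x, 0 < F x)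
    (hfin : ∫⁻ x, ENNReal.ofReal (F x) ≠ ⊤) {i : Fin d} (hi : i.val + 1 = d) :
    ∀ᵐ x : Space d, 0 ≤ lineStretch ρ κ (fun x => ENNReal.ofReal (F x)) (unitVec i) x - 1 -
      Real.log (lineStretch ρ κ (fun x => ENNReal.ofReal (F x)) (unitVec i) x) := by
  have hp0 : ∀ x, ENNReal.ofReal (F x) ≠ 0 := fun x => by simpa using hpos x
  filter_upwards [ae_lineMass_ne_top hF.ennreal_ofReal hfin hi] with x hx
  have := log_lineStretch hρ h0 (hp0 x) ENNReal.ofReal_ne_top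
    (lineMass_ne_zero hF.ennreal_ofReal hp0 (unitVec i) x) hx
  linarith [Real.log_le_sub_one_of_pos this.1]

/-- The logarithmic Sobolev inequality in dual form, up to an arbitrarily small error. -/
theorem IsH1.exists_log_bound_of_pos {ρ : ℝ} (hρ : 0 < ρ) (hd : 1 ≤ d)
    {F : Space d → ℝ} (hF : Measurable F) (hpos : ∀ x, 0 < F x)
    (hfin : ∫⁻ x, ENNReal.ofReal (F x) ≠ ⊤)
    {g : Space d → ℝ} {v : Space d → Space d} (h : IsH1 g v) (hg : ∫ x, g x ^ 2 = 1)
    {δ : ℝ} (hδ : 0 < δ) :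
    ∃ U : Space d → ℝ, Integrable U volume ∧
      (∀ᵐ x : Space d, ρ * Real.log (F x) * g x ^ 2 ≤ U x) ∧
      ∫ x, U x ≤ (∫ x, ‖v x‖ ^ 2) + ρ * Real.log (∫⁻ x, ENNReal.ofReal (F x)).toReal -
        chiValue d ρ + δ := by
  have hd0 : (0 : ℝ) < d := by exact_mod_cast hd
  have hi : (⟨d - 1, by omega⟩ : Fin d).val + 1 = d := by simp; omega
  -- With this κ the truncation cost -dρ log κ equals δ.
  have h0 : 0 < Real.exp (-(δ / (d * ρ))) := Real.exp_pos _
  have h1 : Real.exp (-(δ / (d * ρ))) < 1 := by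
    rw [Real.exp_lt_one_iff]
    have : 0 < δ / (d * ρ) := by positivity
    linarith
  obtain ⟨U, hU, hle, hint⟩ := h.exists_log_bound hρ h0 h1 hF hpos hfin _ hi hg
  refine ⟨U, hU, ?_, ?_⟩
  · filter_upwards [hle, ae_lineStretch_remainder_nonneg hρ h0 hF hpos hfin hi] with x hx hw
    have := mul_nonneg (mul_nonneg hρ.le hw) (sq_nonneg (g x))
    linarith
  · rw [Real.log_exp] at hint
    have : (d : ℝ) * ρ * -(δ / (d * ρ)) = -δ := by field_simp
    linarith

lemma ereal_le_of_forall_pos {x : EReal} {b : ℝ} (h : ∀ δ : ℝ, 0 < δ → x ≤ ((b + δ : ℝ) : EReal)) :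
    x ≤ (b : EReal) := by
  rw [← EReal.le_of_forall_lt_iff_le]
  intro z hz
  have hz' : b < z := by exact_mod_cast hz
  simpa using h (z - b) (sub_pos.2 hz')

/-- The top of the spectrum of `Δ + ψ` is bounded in terms of the exponential integral of `ψ`. -/
theorem spectralTop_le {ρ : ℝ} (hρ : 0 < ρ) (hd : 1 ≤ d) {ψ : Space d → ℝ} (hψ : Measurable ψ)
    (hfin : ∫⁻ x, ENNReal.ofReal (Real.exp (ψ x / ρ)) ≠ ⊤) :
    spectralTop ψ ≤ ((ρ * Real.log (∫⁻ x, ENNReal.ofReal (Real.exp (ψ x / ρ))).toReal -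
      chiValue d ρ : ℝ) : EReal) := by
  apply sSup_le
  rintro a ⟨g, v, h, hg, -, rfl⟩
  apply EReal.sub_le_of_le_add
  rw [← EReal.coe_add]
  apply ereal_le_of_forall_pos
  intro δ hδ
  obtain ⟨U, hU, hle, hint⟩ := h.exists_log_bound_of_pos hρ hd
    (Real.measurable_exp.comp (hψ.div_const ρ)) (fun x => Real.exp_pos _) hfin
    (integral_sq_eq_one h.1 hg) hδ
  refine (extIntegral_le_of_ae_le hU ?_).trans (EReal.coe_le_coe_iff.2 (hint.trans_eq ?_))
  · filter_upwards [hle] with x hx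
    simp only [Function.comp, Real.log_exp] at hx
    rwa [mul_div_cancel₀ _ hρ.ne'] at hx
  · simp only [Function.comp]; ring

lemma lintegral_gaussian_pi :
    ∫⁻ x : Space d, ENNReal.ofReal (Real.exp (-Real.pi * ‖x‖ ^ 2)) = 1 := by
  have h1 := GaussianFourier.integral_rexp_neg_mul_sq_norm (V := Space d) Real.pi_pos
  rw [div_self Real.pi_pos.ne', Real.one_rpow] at h1
  have hi : Integrable (fun x : Space d => Real.exp (-Real.pi * ‖x‖ ^ 2)) volume := by
    by_contra hc
    rw [integral_undef hc] at h1
    norm_num at h1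
  rw [← ofReal_integral_eq_lintegral_ofReal hi (ae_of_all _ fun x => (Real.exp_pos _).le), h1,
    ENNReal.ofReal_one]

/-- The logarithmic Sobolev inequality. -/
theorem le_chi {ρ : ℝ} (hρ : 0 < ρ) (hd : 1 ≤ d) : (chiValue d ρ : EReal) ≤ chi d ρ := by
  apply le_sInf
  rintro a ⟨g, v, h, hg, rfl⟩
  have hg1 := integral_sq_eq_one h.1 hg
  set n := ∫ x, ‖v x‖ ^ 2
  suffices hs : entropy ρ g ≤ ((n - chiValue d ρ : ℝ) : EReal) by
    have := EReal.sub_le_sub (le_refl (n : EReal)) hs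
    refine le_trans (le_of_eq ?_) this
    rw [← EReal.coe_sub, sub_sub_cancel]
  apply ereal_le_of_forall_pos
  intro ε hε
  set k := h.1.1.mk g with hk
  have hkm : Measurable k := h.1.1.stronglyMeasurable_mk.measurable
  have hkg : g =ᵐ[volume] k := h.1.1.ae_eq_mk
  -- The total error is δ + ρ log(1 + δ) ≤ (1 + ρ)δ = ε.
  set δ := ε / (1 + ρ) with hδ
  have hδ0 : 0 < δ := by positivity
  have hGm : Measurable fun x : Space d => Real.exp (-Real.pi * ‖x‖ ^ 2) := by fun_prop
  -- The natural choice F = g² may vanish; a Gaussian of mass δ makes it positive, and the logarithm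
  -- only grows where g ≠ 0.
  set F : Space d → ℝ := fun x => k x ^ 2 + δ * Real.exp (-Real.pi * ‖x‖ ^ 2) with hF
  have hFm : Measurable F := (hkm.pow_const 2).add (hGm.const_mul δ)
  have hFpos : ∀ x, 0 < F x := fun x => by positivity
  have hFint : ∫⁻ x, ENNReal.ofReal (F x) = ENNReal.ofReal (1 + δ) := by
    have e1 : ∀ x, ENNReal.ofReal (F x) = ENNReal.ofReal (k x ^ 2) +
        ENNReal.ofReal δ * ENNReal.ofReal (Real.exp (-Real.pi * ‖x‖ ^ 2)) := fun x => by
      rw [← ENNReal.ofReal_mul hδ0.le, ← ENNReal.ofReal_add (sq_nonneg _) (by positivity)]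
    simp only [e1]
    rw [lintegral_add_left (hkm.pow_const 2).ennreal_ofReal,
      lintegral_const_mul _ hGm.ennreal_ofReal, lintegral_gaussian_pi, mul_one,
      ENNReal.ofReal_add zero_le_one hδ0.le]
    congr 1
    rw [← hg1, ofReal_integral_eq_lintegral_ofReal h.1.integrable_sq
      (ae_of_all _ fun x => sq_nonneg _)]
    apply lintegral_congr_ae
    filter_upwards [hkg] with x hx
    rw [hx]
  obtain ⟨U, hU, hle, hint⟩ := h.exists_log_bound_of_pos hρ hd hFm hFpos
    (by rw [hFint]; exact ENNReal.ofReal_ne_top) hg1 hδ0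
  rw [hFint, ENNReal.toReal_ofReal (by positivity)] at hint
  have hlog : Real.log (1 + δ) ≤ δ := by
    have := Real.log_le_sub_one_of_pos (show 0 < 1 + δ by positivity)
    linarith
  have h1 : extIntegral (fun x => g x ^ 2 * Real.log (g x ^ 2)) ≤
      ((∫ x, U x / ρ : ℝ) : EReal) := by
    apply extIntegral_le_of_ae_le (hU.div_const ρ)
    filter_upwards [hle, hkg] with x hx hgk
    rw [le_div_iff₀ hρ]
    refine le_trans ?_ hx
    rcases (sq_nonneg (g x)).eq_or_lt with h0 | h0
    · rw [← h0]; simp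
    · have hlogle : Real.log (g x ^ 2) ≤ Real.log (F x) := by
        apply Real.log_le_log h0
        simp only [hF, hgk]
        have : 0 < δ * Real.exp (-Real.pi * ‖x‖ ^ 2) := by positivity
        linarith
      nlinarith [mul_le_mul_of_nonneg_left hlogle (mul_nonneg hρ.le h0.le)]
  calc entropy ρ g ≤ (ρ : EReal) * ((∫ x, U x / ρ : ℝ) : EReal) :=
        mul_le_mul_of_nonneg_left h1 (by exact_mod_cast hρ.le)
    _ ≤ _ := by
        rw [← EReal.coe_mul, EReal.coe_le_coe_iff, integral_div, mul_div_cancel₀ _ hρ.ne']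
        have : ε = δ + ρ * δ := by rw [hδ]; field_simp
        nlinarith [mul_le_mul_of_nonneg_left hlog hρ.le]

end

/-! ### The constraint 𝓛(ψ) ≤ 1 as a bound on the exponential integral. -/

section

variable {d : ℕ}

/-- Young's inequality for u ↦ ρ u log u, whose Legendre transform is ρ exp(y/ρ - 1); equality holds
at u = exp(y/ρ - 1). -/
lemma mul_sub_mul_log_le {ρ : ℝ} (hρ : 0 < ρ) (y : ℝ) {u : ℝ} (hu : 0 ≤ u) :
    y * u ≤ ρ * (u * Real.log u) + ρ * Real.exp (y / ρ - 1) := by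
  rcases hu.eq_or_lt with rfl | hu
  · simp; positivity
  · have h1 := Real.add_one_le_exp (y / ρ - 1 - Real.log u)
    rw [Real.exp_sub, Real.exp_log hu, le_div_iff₀ hu] at h1
    have h2 := mul_le_mul_of_nonneg_left h1 hρ.le
    have h3 : ρ * ((y / ρ - 1 - Real.log u + 1) * u) = y * u - ρ * (u * Real.log u) := by
      field_simp; ring
    linarith

lemma lintegral_exp_div_sub_one {ρ : ℝ} (ψ : Space d → ℝ) :
    ∫⁻ x, ENNReal.ofReal (ρ * Real.exp (ψ x / ρ - 1)) =
      ENNReal.ofReal (ρ / Real.exp 1) * ∫⁻ x, ENNReal.ofReal (Real.exp (ψ x / ρ)) := by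
  rw [← lintegral_const_mul' _ _ ENNReal.ofReal_ne_top]
  congr 1; ext x
  rw [← ENNReal.ofReal_mul' (Real.exp_pos _).le, Real.exp_sub]
  congr 1; ring

/-- Allows the Young bound to be integrated in [0, ∞] without subtraction. If a' or b is infinite,
the left side is `⊥`; otherwise `hle` makes all four numbers finite. -/
lemma ereal_sub_sub_mul_le_one {ρ : ℝ} (hρ : 0 < ρ) {a a' b b' : ℝ≥0∞}
    (ha : a ≠ ⊤ ∨ a' ≠ ⊤) (hb : b ≠ ⊤ ∨ b' ≠ ⊤)
    (hle : a + ENNReal.ofReal ρ * b' ≤ a' + ENNReal.ofReal ρ * b + 1) :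
    ((a : EReal) - (a' : EReal)) - (ρ : EReal) * ((b : EReal) - (b' : EReal)) ≤ 1 := by
  by_cases ha' : a' = ⊤
  · have h1 : a ≠ ⊤ := by simpa [ha'] using ha
    subst ha'
    simp
  by_cases hb1 : b = ⊤
  · have h1 : b' ≠ ⊤ := by simpa [hb1] using hb
    subst hb1
    lift b' to NNReal using h1
    have : (⊤ : EReal) - (((b' : ℝ≥0∞)) : EReal) = ⊤ := by
      exact EReal.top_sub_coe (b' : ℝ)
    simp only [EReal.coe_ennreal_top, this, EReal.coe_mul_top_of_pos hρ]
    simp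
  have hR : a' + ENNReal.ofReal ρ * b + 1 ≠ ⊤ := by
    simp [ha', hb1, ENNReal.mul_eq_top]
  have hL := ne_top_of_le_ne_top hR hle
  have h1 : a ≠ ⊤ := fun h => hL (by simp [h])
  have h2 : b' ≠ ⊤ := fun h => hL (by simp [h, hρ])
  have := ENNReal.toReal_mono hR hle
  rw [ENNReal.toReal_add (a := a' + ENNReal.ofReal ρ * b)
      (by simp [ha', hb1, ENNReal.mul_eq_top]) (by simp),
    ENNReal.toReal_add h1 (by simp [h2, ENNReal.mul_eq_top]),
    ENNReal.toReal_add ha' (by simp [hb1, ENNReal.mul_eq_top]), ENNReal.toReal_mul,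
    ENNReal.toReal_mul, ENNReal.toReal_ofReal hρ.le, ENNReal.toReal_one] at this
  rw [← EReal.coe_ennreal_toReal h1, ← EReal.coe_ennreal_toReal ha',
    ← EReal.coe_ennreal_toReal h2, ← EReal.coe_ennreal_toReal hb1]
  norm_cast
  linarith

lemma legendre_le_one {ρ : ℝ} (hρ : 0 < ρ) {ψ : Space d → ℝ} (hψ : Measurable ψ)
    (h : ∫⁻ x, ENNReal.ofReal (Real.exp (ψ x / ρ)) ≤ ENNReal.ofReal (Real.exp 1 / ρ)) :
    legendre ρ ψ ≤ 1 := by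
  apply sSup_le
  rintro a ⟨g, hg, hq1, hq2, rfl⟩
  have hE : ∫⁻ x, ENNReal.ofReal (ρ * Real.exp (ψ x / ρ - 1)) ≤ 1 := by
    rw [lintegral_exp_div_sub_one]
    calc _ ≤ ENNReal.ofReal (ρ / Real.exp 1) * ENNReal.ofReal (Real.exp 1 / ρ) := by gcongr
      _ = 1 := by
        rw [← ENNReal.ofReal_mul (by positivity)]
        field_simp
        simp
  apply ereal_sub_sub_mul_le_one hρ hq1 hq2
  have hgm := hg.1.aemeasurable
  have hBm : AEMeasurable (fun x => g x ^ 2 * Real.log (g x ^ 2)) volume :=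
    (hgm.pow_const 2).mul (Real.measurable_log.comp_aemeasurable (hgm.pow_const 2))
  have hAm : AEMeasurable (fun x => ψ x * g x ^ 2) volume :=
    hψ.aemeasurable.mul (hgm.pow_const 2)
  have hBm' : AEMeasurable (fun x => -(g x ^ 2 * Real.log (g x ^ 2))) volume := hBm.neg
  beta_reduce
  rw [← lintegral_const_mul'' _ hBm.ennreal_ofReal, ← lintegral_const_mul'' _ hBm'.ennreal_ofReal,
    ← lintegral_add_left' hAm.ennreal_ofReal]
  calc _ ≤ ∫⁻ x, (ENNReal.ofReal (-(ψ x * g x ^ 2)) +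
        ENNReal.ofReal ρ * ENNReal.ofReal (g x ^ 2 * Real.log (g x ^ 2)) +
        ENNReal.ofReal (ρ * Real.exp (ψ x / ρ - 1))) := by
        apply lintegral_mono
        intro x
        simp only
        have key := mul_sub_mul_log_le hρ (ψ x) (sq_nonneg (g x))
        have hE0 : 0 ≤ ρ * Real.exp (ψ x / ρ - 1) := by positivity
        rw [← ENNReal.ofReal_mul hρ.le, ← ENNReal.ofReal_mul hρ.le]
        generalize ψ x * g x ^ 2 = A at *
        generalize g x ^ 2 * Real.log (g x ^ 2) = B at *
        generalize ρ * Real.exp (ψ x / ρ - 1) = E at *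
        have hm : ρ * -B = -(ρ * B) := by ring
        rw [hm]
        generalize ρ * B = B at *
        -- With A⁺ - A⁻ = A and B⁺ - B⁻ = B, this is the pointwise Young bound A ≤ B + E; the sign
        -- cases check it.
        simp only [ENNReal.ofReal, ← ENNReal.coe_add, ENNReal.coe_le_coe]
        rw [← NNReal.coe_le_coe]
        push_cast
        simp only [Real.coe_toNNReal']
        rcases max_cases A 0 with h1 | h1 <;> rcases max_cases B 0 with h2 | h2 <;>
        rcases max_cases (-A) 0 with h3 | h3 <;> rcases max_cases (-B) 0 with h4 | h4 <;>
        rw [h1.1, h2.1, h3.1, h4.1, max_eq_left hE0] <;> linarith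
    _ = (∫⁻ x, ENNReal.ofReal (-(ψ x * g x ^ 2))) +
        (∫⁻ x, ENNReal.ofReal ρ * ENNReal.ofReal (g x ^ 2 * Real.log (g x ^ 2))) +
        ∫⁻ x, ENNReal.ofReal (ρ * Real.exp (ψ x / ρ - 1)) := by
        rw [lintegral_add_right', lintegral_add_left']
        · exact hAm.neg.ennreal_ofReal
        · exact (((Real.measurable_exp.comp ((hψ.div_const ρ).sub_const 1)).const_mul
            ρ).ennreal_ofReal).aemeasurable
    _ ≤ _ := by gcongr

/-- The pointwise optimiser g² = exp(ψ/ρ - 1), cut off to a ball, is admissible because ψ is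
continuous; it attains equality in Young's inequality there. The balls then exhaust the space. -/
lemma lintegral_exp_le_of_legendre_le_one {ρ : ℝ} (hρ : 0 < ρ) {ψ : Space d → ℝ}
    (hψ : Continuous ψ) (h : legendre ρ ψ ≤ 1) :
    ∫⁻ x, ENNReal.ofReal (Real.exp (ψ x / ρ)) ≤ ENNReal.ofReal (Real.exp 1 / ρ) := by
  have key : ∀ n : ℕ, ∫⁻ x in Metric.closedBall (0 : Space d) n,
      ENNReal.ofReal (Real.exp (ψ x / ρ)) ≤ ENNReal.ofReal (Real.exp 1 / ρ) := by
    intro n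
    set B := Metric.closedBall (0 : Space d) n
    have hB : MeasurableSet B := Metric.isClosed_closedBall.measurableSet
    have hBc : IsCompact B := isCompact_closedBall _ _
    set E : Space d → ℝ := fun x => Real.exp (ψ x / ρ - 1) with hE
    have hEc : Continuous E := by fun_prop
    set g : Space d → ℝ := B.indicator fun x => Real.sqrt (E x) with hg
    have hg2 : ∀ x, g x ^ 2 = B.indicator E x := by
      intro x
      by_cases hx : x ∈ B
      · simp [hg, hx, Real.sq_sqrt (Real.exp_pos _).le, hE]
      · simp [hg, hx]
    have hint : ∀ f : Space d → ℝ, Continuous f → Integrable (B.indicator f) volume :=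
      fun f hf => (integrable_indicator_iff hB).2 (hf.continuousOn.integrableOn_compact hBc)
    have hgL : MemLp g 2 volume := by
      rw [memLp_two_iff_integrable_sq]
      · simp only [hg2]; exact hint E hEc
      · exact ((hEc.sqrt).measurable.indicator hB).aestronglyMeasurable
    have e1 : (fun x => ψ x * g x ^ 2) = B.indicator fun x => ψ x * E x := by
      ext x; rw [hg2]; by_cases hx : x ∈ B <;> simp [hx]
    have e2 : (fun x => g x ^ 2 * Real.log (g x ^ 2)) =
        B.indicator fun x => E x * (ψ x / ρ - 1) := by
      ext x; rw [hg2]; by_cases hx : x ∈ B <;> simp [hx, hE]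
    have i1 : Integrable (fun x => ψ x * g x ^ 2) volume := by
      rw [e1]; exact hint _ (hψ.mul hEc)
    have i2 : Integrable (fun x => g x ^ 2 * Real.log (g x ^ 2)) volume := by
      rw [e2]; exact hint _ (by fun_prop)
    have hle : pairing ψ g - entropy ρ g ≤ legendre ρ ψ := le_sSup ⟨g, hgL,
      quasiIntegrable_of_integrable i1, quasiIntegrable_of_integrable i2, rfl⟩
    replace hle := hle.trans h
    rw [pairing, entropy, extIntegral_eq_integral i1, extIntegral_eq_integral i2] at hle
    norm_cast at hle
    rw [← integral_const_mul, ← integral_sub i1 (i2.const_mul ρ)] at hle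
    have e3 : ∀ x, ψ x * g x ^ 2 - ρ * (g x ^ 2 * Real.log (g x ^ 2)) =
        B.indicator (fun x => ρ * Real.exp (ψ x / ρ - 1)) x := by
      intro x
      have h1 := congrFun e1 x
      have h2 := congrFun e2 x
      beta_reduce at h1 h2
      rw [h1, h2]
      by_cases hx : x ∈ B
      · simp only [hx, Set.indicator_of_mem, hE]; field_simp; ring
      · simp [hx]
    simp only [e3] at hle
    rw [integral_indicator hB] at hle
    have hcong : ∫ x in B, ρ * Real.exp (ψ x / ρ - 1) =
        ρ / Real.exp 1 * ∫ x in B, Real.exp (ψ x / ρ) := by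
      rw [← integral_const_mul]; congr 1; ext x; rw [Real.exp_sub]; ring
    rw [hcong] at hle
    rw [← ofReal_integral_eq_lintegral_ofReal
      ((by fun_prop : Continuous fun x => Real.exp (ψ x / ρ)).continuousOn.integrableOn_compact hBc)
      (ae_of_all _ fun x => (Real.exp_pos _).le)]
    apply ENNReal.ofReal_le_ofReal
    rw [le_div_iff₀ hρ]
    have h5 := Real.exp_pos 1
    rw [div_mul_eq_mul_div, div_le_one h5] at hle
    linarith
  have hcov : AECover (volume : Measure (Space d)) atTop
      (fun n : ℕ => Metric.closedBall (0 : Space d) n) :=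
    aecover_closedBall tendsto_natCast_atTop_atTop
  have hm : Measurable fun x => ENNReal.ofReal (Real.exp (ψ x / ρ)) :=
    (Real.measurable_exp.comp (hψ.measurable.div_const ρ)).ennreal_ofReal
  exact le_of_tendsto (hcov.lintegral_tendsto_of_countably_generated hm.aemeasurable)
    (Eventually.of_forall key)

end

/-! ### Gaussian computations and the values of χ and χ̃. -/

section

variable {d : ℕ}

lemma integrable_exp_neg_mul_norm_sq {b : ℝ} (hb : 0 < b) :
    Integrable (fun x : Space d => Real.exp (-b * ‖x‖ ^ 2)) volume := by
  by_contra hc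
  have h := GaussianFourier.integral_rexp_neg_mul_sq_norm (V := Space d) hb
  rw [integral_undef hc] at h
  have : 0 < (Real.pi / b) ^ ((Module.finrank ℝ (Space d) : ℝ) / 2) :=
    Real.rpow_pos_of_pos (div_pos Real.pi_pos hb) _
  linarith

lemma integrable_norm_sq_mul_exp {b : ℝ} (hb : 0 < b) :
    Integrable (fun x : Space d => ‖x‖ ^ 2 * Real.exp (-b * ‖x‖ ^ 2)) volume := by
  refine ((integrable_exp_neg_mul_norm_sq (d := d) (half_pos hb)).const_mul (2 / b)).mono'
    (by fun_prop) (ae_of_all _ fun x => ?_)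
  rw [Real.norm_of_nonneg (by positivity)]
  have h1 := Real.add_one_le_exp (b / 2 * ‖x‖ ^ 2)
  have h2 : Real.exp (-(b / 2) * ‖x‖ ^ 2) =
      Real.exp (b / 2 * ‖x‖ ^ 2) * Real.exp (-b * ‖x‖ ^ 2) := by
    rw [← Real.exp_add]; congr 1; ring
  rw [h2, ← mul_assoc]
  apply mul_le_mul_of_nonneg_right _ (Real.exp_pos _).le
  have h3 : ‖x‖ ^ 2 = 2 / b * (b / 2 * ‖x‖ ^ 2) := by field_simp
  calc ‖x‖ ^ 2 = 2 / b * (b / 2 * ‖x‖ ^ 2) := h3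
    _ ≤ _ := by gcongr; linarith

lemma hasFDerivAt_exp_neg_mul_norm_sq (b : ℝ) (x : Space d) :
    HasFDerivAt (fun x : Space d => Real.exp (-b * ‖x‖ ^ 2))
      ((-2 * b * Real.exp (-b * ‖x‖ ^ 2)) • innerSL ℝ x) x := by
  have h := ((hasStrictFDerivAt_norm_sq x).hasFDerivAt.const_mul (-b)).exp
  convert! h using 1
  ext w
  simp
  ring

/-- Integration by parts of x_i against ∂_i exp(-b|x|²) = -2b x_i exp(-b|x|²), summed over i. -/
lemma two_mul_integral_norm_sq_mul_exp {b : ℝ} (hb : 0 < b) :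
    2 * b * ∫ x : Space d, ‖x‖ ^ 2 * Real.exp (-b * ‖x‖ ^ 2) =
      d * ∫ x : Space d, Real.exp (-b * ‖x‖ ^ 2) := by
  set u : Space d → ℝ := fun x => Real.exp (-b * ‖x‖ ^ 2) with hu
  have hi0 : Integrable u volume := integrable_exp_neg_mul_norm_sq hb
  have hi2 : Integrable (fun x => ‖x‖ ^ 2 * u x) volume := integrable_norm_sq_mul_exp hb
  have huc : Continuous u := by fun_prop
  have hcoord : ∀ (i : Fin d) (x : Space d), |x i| ^ 2 ≤ ‖x‖ ^ 2 := fun i x => by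
    have := PiLp.norm_apply_le x i
    rw [Real.norm_eq_abs] at this
    exact pow_le_pow_left₀ (abs_nonneg _) this 2
  have hisq : ∀ i : Fin d, Integrable (fun x : Space d => x i ^ 2 * u x) volume := fun i => by
    refine hi2.mono' (by fun_prop) (ae_of_all _ fun x => ?_)
    rw [Real.norm_of_nonneg (by positivity)]
    apply mul_le_mul_of_nonneg_right _ (Real.exp_pos _).le
    rw [← sq_abs]; exact hcoord i x
  have hi1 : ∀ i : Fin d, Integrable (fun x : Space d => x i * u x) volume := fun i => by
    refine (hi0.add hi2).mono' (by fun_prop) (ae_of_all _ fun x => ?_)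
    rw [Pi.add_apply, norm_mul, Real.norm_eq_abs, Real.norm_of_nonneg (Real.exp_pos _).le]
    have := hcoord i x
    have h3 : |x i| ≤ 1 + ‖x‖ ^ 2 := by nlinarith [sq_nonneg (|x i| - 1), abs_nonneg (x i)]
    calc |x i| * u x ≤ (1 + ‖x‖ ^ 2) * u x :=
          mul_le_mul_of_nonneg_right h3 (Real.exp_pos _).le
      _ = _ := by ring
  have key : ∀ i : Fin d, 2 * b * ∫ x : Space d, x i ^ 2 * u x = ∫ x, u x := by
    intro i
    have hfu : ∀ x, fderiv ℝ u x (unitVec i) = -2 * b * (x i * u x) := fun x => by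
      rw [(hasFDerivAt_exp_neg_mul_norm_sq b x).fderiv]
      simp [unitVec, EuclideanSpace.inner_single_right, hu]
      ring
    have hfp : ∀ x : Space d, HasFDerivAt (fun x : Space d => x i)
        (EuclideanSpace.proj (𝕜 := ℝ) i : Space d →L[ℝ] ℝ) x := fun x =>
      (EuclideanSpace.proj (𝕜 := ℝ) i : Space d →L[ℝ] ℝ).hasFDerivAt
    have hfx : ∀ x, fderiv ℝ (fun x : Space d => x i) x (unitVec i) = 1 := fun x => by
      rw [(hfp x).fderiv]; simp [unitVec]
    have h := integral_mul_fderiv_eq_neg_fderiv_mul_of_integrable (μ := volume)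
      (f := fun x : Space d => x i) (g := u) (v := unitVec i)
      (by simp only [hfx, one_mul]; exact hi0)
      (by
        simp only [hfu]
        refine ((hisq i).const_mul (-2 * b)).congr (ae_of_all _ fun x => ?_)
        simp only; ring)
      (hi1 i) (fun x _ => (hfp x).differentiableAt)
      (fun x _ => (hasFDerivAt_exp_neg_mul_norm_sq b x).differentiableAt)
    simp only [hfx, hfu, one_mul] at h
    have h2 : ∫ x : Space d, x i * (-2 * b * (x i * u x)) =
        -(2 * b * ∫ x : Space d, x i ^ 2 * u x) := by
      rw [← integral_const_mul, ← integral_neg]; congr 1; ext x; ring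
    rw [h2] at h
    linarith
  have hsum : ∫ x : Space d, ‖x‖ ^ 2 * u x = ∑ i, ∫ x : Space d, x i ^ 2 * u x := by
    rw [← integral_finsetSum _ fun i _ => hisq i]
    congr 1; ext x
    rw [EuclideanSpace.norm_sq_eq, Finset.sum_mul]
    simp
  rw [hsum, Finset.mul_sum, Finset.sum_congr rfl fun i _ => key i]
  simp

/-- The centred Gaussian optimiser of the logarithmic Sobolev inequality. -/
def gaussGround (d : ℕ) (ρ : ℝ) (x : Space d) : ℝ :=
  Real.sqrt ((ρ / Real.pi) ^ ((d : ℝ) / 2)) * Real.exp (-(ρ / 2) * ‖x‖ ^ 2)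

/-- The gradient of `gaussGround`. -/
def gaussGroundGrad (d : ℕ) (ρ : ℝ) (x : Space d) : Space d := (-ρ * gaussGround d ρ x) • x

variable {ρ : ℝ}

lemma gaussGround_sq (hρ : 0 < ρ) (x : Space d) : gaussGround d ρ x ^ 2 =
    (ρ / Real.pi) ^ ((d : ℝ) / 2) * Real.exp (-ρ * ‖x‖ ^ 2) := by
  rw [gaussGround, mul_pow, Real.sq_sqrt (Real.rpow_nonneg (div_pos hρ Real.pi_pos).le _),
    ← Real.exp_nat_mul]
  congr 2; push_cast; ring

lemma integral_gaussGround_sq (hρ : 0 < ρ) : ∫ x, gaussGround d ρ x ^ 2 = 1 := by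
  simp only [gaussGround_sq hρ]
  rw [integral_const_mul, GaussianFourier.integral_rexp_neg_mul_sq_norm hρ]
  have hpi := Real.pi_pos
  simp only [finrank_euclideanSpace, Fintype.card_fin]
  rw [← Real.mul_rpow (by positivity) (by positivity)]
  have : ρ / Real.pi * (Real.pi / ρ) = 1 := by field_simp
  rw [this, Real.one_rpow]

lemma integrable_gaussGround_sq (hρ : 0 < ρ) :
    Integrable (fun x => gaussGround d ρ x ^ 2) volume := by
  simp only [gaussGround_sq hρ]
  exact (integrable_exp_neg_mul_norm_sq hρ).const_mul _

lemma integrable_norm_sq_mul_gaussGround_sq (hρ : 0 < ρ) :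
    Integrable (fun x => ‖x‖ ^ 2 * gaussGround d ρ x ^ 2) volume := by
  simp only [gaussGround_sq hρ]
  refine ((integrable_norm_sq_mul_exp (d := d) hρ).const_mul
    ((ρ / Real.pi) ^ ((d : ℝ) / 2))).congr (ae_of_all _ fun x => ?_)
  simp only; ring

lemma integral_norm_sq_mul_gaussGround_sq (hρ : 0 < ρ) :
    ∫ x, ‖x‖ ^ 2 * gaussGround d ρ x ^ 2 = d / (2 * ρ) := by
  have h1 : ∫ x, ‖x‖ ^ 2 * gaussGround d ρ x ^ 2 = (ρ / Real.pi) ^ ((d : ℝ) / 2) *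
      ∫ x : Space d, ‖x‖ ^ 2 * Real.exp (-ρ * ‖x‖ ^ 2) := by
    rw [← integral_const_mul]; congr 1; ext x; rw [gaussGround_sq hρ]; ring
  have h2 := integral_gaussGround_sq (d := d) hρ
  simp only [gaussGround_sq hρ] at h2
  rw [integral_const_mul] at h2
  have h3 := two_mul_integral_norm_sq_mul_exp (d := d) hρ
  rw [h1, eq_div_iff (by positivity)]
  linear_combination (d : ℝ) * h2 + (ρ / Real.pi) ^ ((d : ℝ) / 2) * h3

lemma norm_sq_gaussGroundGrad (x : Space d) :
    ‖gaussGroundGrad d ρ x‖ ^ 2 = ρ ^ 2 * (‖x‖ ^ 2 * gaussGround d ρ x ^ 2) := by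
  rw [gaussGroundGrad, norm_smul, mul_pow, Real.norm_eq_abs, sq_abs]; ring

lemma continuous_gaussGround : Continuous (gaussGround d ρ) := by
  unfold gaussGround; fun_prop

lemma isH1_gaussGround (hρ : 0 < ρ) : IsH1 (gaussGround d ρ) (gaussGroundGrad d ρ) := by
  have hvc : Continuous (gaussGroundGrad d ρ) := by
    have := continuous_gaussGround (d := d) (ρ := ρ)
    unfold gaussGroundGrad; fun_prop
  have hder : ∀ x, HasFDerivAt (gaussGround d ρ)
      ((-ρ * gaussGround d ρ x) • innerSL ℝ x) x := fun x => by
    have h := (hasFDerivAt_exp_neg_mul_norm_sq (ρ / 2) x).const_mul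
      (Real.sqrt ((ρ / Real.pi) ^ ((d : ℝ) / 2)))
    convert! h using 1
    rw [smul_smul]; congr 1; unfold gaussGround; ring
  refine ⟨?_, ?_, ?_⟩
  · rw [memLp_two_iff_integrable_sq continuous_gaussGround.aestronglyMeasurable]
    exact integrable_gaussGround_sq hρ
  · rw [memLp_two_iff_integrable_sq_norm hvc.aestronglyMeasurable]
    simp only [norm_sq_gaussGroundGrad]
    exact (integrable_norm_sq_mul_gaussGround_sq hρ).const_mul _
  · intro φ hφ hc w
    have hφ1 : ContDiff ℝ 1 φ := hφ.of_le (by exact_mod_cast le_top)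
    have hfd : ∀ x, fderiv ℝ (gaussGround d ρ) x w = inner ℝ (gaussGroundGrad d ρ x) w :=
      fun x => by rw [(hder x).fderiv]; simp [gaussGroundGrad, inner_smul_left]
    have hφd : Continuous fun x => fderiv ℝ φ x w :=
      (hφ1.continuous_fderiv one_ne_zero).clm_apply continuous_const
    rw [integral_mul_fderiv_eq_neg_fderiv_mul_of_integrable]
    · simp only [hfd]
      congr 2; ext x; ring
    · simp only [hfd]
      exact Continuous.integrable_of_hasCompactSupport
        ((hvc.inner continuous_const).mul hφ.continuous) hc.mul_left
    · exact Continuous.integrable_of_hasCompactSupport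
        (continuous_gaussGround.mul hφd) (hc.fderiv_apply ℝ w).mul_left
    · exact Continuous.integrable_of_hasCompactSupport
        (continuous_gaussGround.mul hφ.continuous) hc.mul_left
    · exact fun x _ => (hder x).differentiableAt
    · exact fun x _ => (hφ1.differentiable one_ne_zero).differentiableAt

lemma integral_norm_sq_gaussGroundGrad (hρ : 0 < ρ) :
    ∫ x, ‖gaussGroundGrad d ρ x‖ ^ 2 = ρ * d / 2 := by
  simp only [norm_sq_gaussGroundGrad]
  rw [integral_const_mul, integral_norm_sq_mul_gaussGround_sq hρ]
  field_simp

lemma eLpNorm_gaussGround (hρ : 0 < ρ) : eLpNorm (gaussGround d ρ) 2 volume = 1 :=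
  eLpNorm_eq_one (isH1_gaussGround hρ).1 (integral_gaussGround_sq hρ)

lemma chi_eq (hρ : 0 < ρ) (hd : 1 ≤ d) : chi d ρ = (chiValue d ρ : EReal) := by
  refine le_antisymm (sInf_le ⟨gaussGround d ρ, gaussGroundGrad d ρ, isH1_gaussGround hρ,
    eLpNorm_gaussGround hρ, ?_⟩) (le_chi hρ hd)
  have hN : 0 < (ρ / Real.pi) ^ ((d : ℝ) / 2) := Real.rpow_pos_of_pos (div_pos hρ Real.pi_pos) _
  have he : (fun x => gaussGround d ρ x ^ 2 * Real.log (gaussGround d ρ x ^ 2)) = fun x =>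
      (d : ℝ) / 2 * Real.log (ρ / Real.pi) * gaussGround d ρ x ^ 2 -
        ρ * (‖x‖ ^ 2 * gaussGround d ρ x ^ 2) := by
    ext x
    have : Real.log (gaussGround d ρ x ^ 2) =
        (d : ℝ) / 2 * Real.log (ρ / Real.pi) - ρ * ‖x‖ ^ 2 := by
      rw [gaussGround_sq hρ, Real.log_mul hN.ne' (Real.exp_pos _).ne', Real.log_exp,
        Real.log_rpow (div_pos hρ Real.pi_pos)]
      ring
    rw [this]; ring
  have i1 := (integrable_gaussGround_sq (d := d) hρ).const_mul
    ((d : ℝ) / 2 * Real.log (ρ / Real.pi))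
  have i2 := (integrable_norm_sq_mul_gaussGround_sq (d := d) hρ).const_mul ρ
  have i3 : Integrable (fun x => (d : ℝ) / 2 * Real.log (ρ / Real.pi) * gaussGround d ρ x ^ 2 -
      ρ * (‖x‖ ^ 2 * gaussGround d ρ x ^ 2)) volume := i1.sub i2
  rw [integral_norm_sq_gaussGroundGrad hρ, entropy, he, extIntegral_eq_integral i3,
    integral_sub i1 i2, integral_const_mul, integral_const_mul, integral_gaussGround_sq hρ,
    integral_norm_sq_mul_gaussGround_sq hρ]
  norm_cast
  unfold chiValue
  field_simp
  ring

/-- The value of the variational problem for `χ̃(ρ)`. -/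
def chiTildeValue (d : ℕ) (ρ : ℝ) : ℝ := chiValue d ρ + ρ * Real.log (ρ / Real.exp 1)

lemma log_div_exp_one (hρ : 0 < ρ) : Real.log (ρ / Real.exp 1) = Real.log ρ - 1 := by
  rw [Real.log_div hρ.ne' (Real.exp_pos _).ne', Real.log_exp]

/-- The integrand is e/ρ times the squared ground state, so the parabola saturates the constraint;
this explains its additive constants. -/
lemma lintegral_exp_parabola (hρ : 0 < ρ) :
    ∫⁻ x : Space d, ENNReal.ofReal (Real.exp ((parabola d ρ x - ρ * Real.log ρ) / ρ)) =
      ENNReal.ofReal (Real.exp 1 / ρ) := by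
  have h : ∀ x : Space d, Real.exp ((parabola d ρ x - ρ * Real.log ρ) / ρ) =
      Real.exp 1 / ρ * gaussGround d ρ x ^ 2 := fun x => by
    have e1 : (parabola d ρ x - ρ * Real.log ρ) / ρ =
        1 - Real.log ρ + (Real.log (ρ / Real.pi) * ((d : ℝ) / 2) + -ρ * ‖x‖ ^ 2) := by
      unfold parabola; field_simp; ring
    rw [gaussGround_sq hρ, e1, Real.exp_add, Real.exp_sub, Real.exp_log hρ, Real.exp_add,
      Real.rpow_def_of_pos (div_pos hρ Real.pi_pos)]
  simp only [h]
  rw [← ofReal_integral_eq_lintegral_ofReal ((integrable_gaussGround_sq hρ).const_mul _)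
    (ae_of_all _ fun x => by positivity), integral_const_mul, integral_gaussGround_sq hρ, mul_one]

lemma le_spectralTop_parabola (hρ : 0 < ρ) : ((-chiTildeValue d ρ : ℝ) : EReal) ≤
    spectralTop fun x : Space d => parabola d ρ x - ρ * Real.log ρ := by
  have he : (fun x => (parabola d ρ x - ρ * Real.log ρ) * gaussGround d ρ x ^ 2) = fun x =>
      (ρ + ρ * ((d : ℝ) / 2) * Real.log (ρ / Real.pi) - ρ * Real.log ρ) *
        gaussGround d ρ x ^ 2 - ρ ^ 2 * (‖x‖ ^ 2 * gaussGround d ρ x ^ 2) := by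
    ext x; unfold parabola; ring
  have i1 := (integrable_gaussGround_sq (d := d) hρ).const_mul
    (ρ + ρ * ((d : ℝ) / 2) * Real.log (ρ / Real.pi) - ρ * Real.log ρ)
  have i2 := (integrable_norm_sq_mul_gaussGround_sq (d := d) hρ).const_mul (ρ ^ 2)
  have i3 : Integrable (fun x => (ρ + ρ * ((d : ℝ) / 2) * Real.log (ρ / Real.pi) -
      ρ * Real.log ρ) * gaussGround d ρ x ^ 2 - ρ ^ 2 * (‖x‖ ^ 2 * gaussGround d ρ x ^ 2))
      volume := i1.sub i2
  refine le_sSup ⟨gaussGround d ρ, gaussGroundGrad d ρ, isH1_gaussGround hρ,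
    eLpNorm_gaussGround hρ, ?_, ?_⟩
  · rw [he]; exact quasiIntegrable_of_integrable i3
  · rw [integral_norm_sq_gaussGroundGrad hρ, pairing, he, extIntegral_eq_integral i3,
      integral_sub i1 i2, integral_const_mul, integral_const_mul, integral_gaussGround_sq hρ,
      integral_norm_sq_mul_gaussGround_sq hρ]
    norm_cast
    rw [chiTildeValue, log_div_exp_one hρ]
    unfold chiValue
    field_simp
    ring

lemma lintegral_ofReal_exp_ne_zero {f : Space d → ℝ} (hf : Measurable f) :
    ∫⁻ x, ENNReal.ofReal (Real.exp (f x)) ≠ 0 := by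
  rw [Ne, lintegral_eq_zero_iff (by fun_prop)]
  intro hc
  have h3 : ∀ᵐ x : Space d, False := by
    filter_upwards [hc] with x hx
    simp only [Pi.zero_apply, ENNReal.ofReal_eq_zero] at hx
    exact (Real.exp_pos _).not_ge hx
  simp at h3
  exact NeZero.ne _ h3

/-- The bound of `spectralTop_le` is increasing in the exponential integral, and at e/ρ it equals
`-chiTildeValue d ρ`. -/
lemma spectralTop_le_of_legendre_le_one (hρ : 0 < ρ) (hd : 1 ≤ d) {ψ : Space d → ℝ}
    (hψ : Continuous ψ)
    (h : ∫⁻ x, ENNReal.ofReal (Real.exp (ψ x / ρ)) ≤ ENNReal.ofReal (Real.exp 1 / ρ)) :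
    spectralTop ψ ≤ ((-chiTildeValue d ρ : ℝ) : EReal) := by
  have hfin := ne_top_of_le_ne_top ENNReal.ofReal_ne_top h
  refine (spectralTop_le hρ hd hψ.measurable hfin).trans (EReal.coe_le_coe_iff.2 ?_)
  have h2 := ENNReal.toReal_mono ENNReal.ofReal_ne_top h
  rw [ENNReal.toReal_ofReal (by positivity)] at h2
  have h0 : 0 < (∫⁻ x, ENNReal.ofReal (Real.exp (ψ x / ρ))).toReal := by
    exact ENNReal.toReal_pos (lintegral_ofReal_exp_ne_zero (hψ.measurable.div_const ρ)) hfin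
  have h4 := mul_le_mul_of_nonneg_left (Real.log_le_log h0 h2) hρ.le
  rw [Real.log_div (Real.exp_pos _).ne' hρ.ne', Real.log_exp] at h4
  rw [chiTildeValue, log_div_exp_one hρ]
  linarith

lemma continuous_parabola : Continuous (parabola d ρ) := by
  unfold parabola; fun_prop

lemma chiTilde_eq (hρ : 0 < ρ) (hd : 1 ≤ d) : chiTilde d ρ = (chiTildeValue d ρ : EReal) := by
  apply le_antisymm
  · refine (sInf_le ⟨fun x => parabola d ρ x - ρ * Real.log ρ,
      continuous_parabola.sub continuous_const,
      legendre_le_one hρ (continuous_parabola.sub continuous_const).measurable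
        (lintegral_exp_parabola hρ).le, rfl⟩ : chiTilde d ρ ≤ _).trans ?_
    rw [EReal.neg_le]
    exact_mod_cast le_spectralTop_parabola hρ
  · apply le_sInf
    rintro a ⟨ψ, hψ, hle, rfl⟩
    rw [EReal.le_neg]
    exact_mod_cast spectralTop_le_of_legendre_le_one hρ hd hψ
      (lintegral_exp_le_of_legendre_le_one hρ hψ hle)

/-- Minimisers in terms of the exponential integral. -/
lemma isMinimizer_iff (hρ : 0 < ρ) (hd : 1 ≤ d) (ψ : Space d → ℝ) : IsMinimizer ρ ψ ↔
    Continuous ψ ∧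
    ∫⁻ x, ENNReal.ofReal (Real.exp (ψ x / ρ)) ≤ ENNReal.ofReal (Real.exp 1 / ρ) ∧
    spectralTop ψ = ((-chiTildeValue d ρ : ℝ) : EReal) := by
  unfold IsMinimizer
  rw [chiTilde_eq hρ hd]
  constructor
  · rintro ⟨h1, h2, h3⟩
    refine ⟨h1, lintegral_exp_le_of_legendre_le_one hρ h1 h2, ?_⟩
    rw [EReal.coe_neg, ← h3, neg_neg]
  · rintro ⟨h1, h2, h3⟩
    refine ⟨h1, legendre_le_one hρ h1.measurable h2, ?_⟩
    rw [h3, EReal.coe_neg, neg_neg]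

end

/-! ### Invariance under isometries. -/

section

variable {d : ℕ}

lemma measurePreserving_isometry (R : Space d ≃ₗᵢ[ℝ] Space d) (a : Space d) :
    MeasurePreserving (fun x => R x + a) volume volume :=
  (measurePreserving_add_right volume a).comp R.measurePreserving

lemma measurableEmbedding_isometry (R : Space d ≃ₗᵢ[ℝ] Space d) (a : Space d) :
    MeasurableEmbedding (fun x => R x + a) :=
  (R.toHomeomorph.trans (Homeomorph.addRight a)).measurableEmbedding

lemma lintegral_comp_isometry (R : Space d ≃ₗᵢ[ℝ] Space d) (a : Space d) (f : Space d → ℝ≥0∞) :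
    ∫⁻ x, f (R x + a) = ∫⁻ x, f x :=
  (measurePreserving_isometry R a).lintegral_comp_emb (measurableEmbedding_isometry R a) f

lemma integral_comp_isometry (R : Space d ≃ₗᵢ[ℝ] Space d) (a : Space d) (f : Space d → ℝ) :
    ∫ x, f (R x + a) = ∫ x, f x :=
  (measurePreserving_isometry R a).integral_comp (measurableEmbedding_isometry R a) f

lemma IsH1.comp_isometry {g : Space d → ℝ} {v : Space d → Space d} (h : IsH1 g v)
    (R : Space d ≃ₗᵢ[ℝ] Space d) (a : Space d) :
    IsH1 (fun x => g (R x + a)) (fun x => R.symm (v (R x + a))) := by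
  have hmp := measurePreserving_isometry R a
  refine ⟨h.1.comp_measurePreserving hmp, ?_, ?_⟩
  · have h1 : MemLp (fun x => v (R x + a)) 2 volume := h.2.1.comp_measurePreserving hmp
    refine MemLp.of_le h1 (R.symm.continuous.comp_aestronglyMeasurable h1.1)
      (ae_of_all _ fun x => ?_)
    simp
  · intro φ hφ hc w
    have hφ0 : ContDiff ℝ 1 φ := hφ.of_le (by exact_mod_cast le_top)
    have hφ1 : Differentiable ℝ φ := hφ0.differentiable one_ne_zero
    -- The test function is carried forward by the isometry and the direction w is replaced by R w.
    set χ : Space d → ℝ := fun y => φ (R.symm (y - a)) with hχ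
    have hχs : ContDiff ℝ ∞ χ :=
      hφ.comp (R.symm.contDiff.comp (contDiff_id.sub contDiff_const))
    have hχc : HasCompactSupport χ :=
      hc.comp_homeomorph ((Homeomorph.subRight a).trans R.symm.toHomeomorph)
    have hfd : ∀ y, fderiv ℝ χ y (R w) = fderiv ℝ φ (R.symm (y - a)) w := by
      intro y
      have h2 : HasFDerivAt (fun y : Space d => R.symm (y - a))
          (R.symm.toContinuousLinearEquiv : Space d →L[ℝ] Space d) y := by
        have := (R.symm.toContinuousLinearEquiv : Space d →L[ℝ] Space d).hasFDerivAt.comp y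
          ((hasFDerivAt_id y).sub_const a)
        rw [ContinuousLinearMap.comp_id] at this
        exact this
      have h3 := ((hφ1 (R.symm (y - a))).hasFDerivAt.comp y h2).fderiv
      have h4 : fderiv ℝ χ y = _ := h3
      rw [h4]
      simp
    have key := h.2.2 χ hχs hχc (R w)
    rw [← integral_comp_isometry R a, ← integral_comp_isometry R a (fun x => χ x * _)] at key
    simp only [hfd] at key
    simp only [hχ, add_sub_cancel_right, LinearIsometryEquiv.symm_apply_apply] at key
    rw [key]
    congr 2; ext x
    congr 1
    rw [← R.inner_map_map (R.symm (v (R x + a))) w, R.apply_symm_apply]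

lemma extIntegral_comp_isometry (R : Space d ≃ₗᵢ[ℝ] Space d) (a : Space d) (f : Space d → ℝ) :
    extIntegral (fun x => f (R x + a)) = extIntegral f := by
  unfold extIntegral
  rw [lintegral_comp_isometry R a fun x => ENNReal.ofReal (f x),
    lintegral_comp_isometry R a fun x => ENNReal.ofReal (-f x)]

lemma spectralTop_le_comp_isometry (R : Space d ≃ₗᵢ[ℝ] Space d) (a : Space d) (ψ : Space d → ℝ) :
    spectralTop ψ ≤ spectralTop fun x => ψ (R x + a) := by
  apply sSup_le
  rintro _ ⟨g, v, h, hg, hq, rfl⟩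
  refine le_sSup ⟨_, _, h.comp_isometry R a, ?_, ?_, ?_⟩
  · have := eLpNorm_comp_measurePreserving (p := 2) h.1.1 (measurePreserving_isometry R a)
    rw [← hg, ← this]
    rfl
  · unfold QuasiIntegrable at hq ⊢
    rwa [lintegral_comp_isometry R a fun x => ENNReal.ofReal (ψ x * g x ^ 2),
      lintegral_comp_isometry R a fun x => ENNReal.ofReal (-(ψ x * g x ^ 2))]
  · unfold pairing
    rw [extIntegral_comp_isometry R a fun x => ψ x * g x ^ 2]
    simp only [LinearIsometryEquiv.norm_map]
    rw [integral_comp_isometry R a fun x => ‖v x‖ ^ 2]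

lemma spectralTop_comp_isometry (R : Space d ≃ₗᵢ[ℝ] Space d) (a : Space d) (ψ : Space d → ℝ) :
    (spectralTop fun x => ψ (R x + a)) = spectralTop ψ := by
  refine le_antisymm ?_ (spectralTop_le_comp_isometry R a ψ)
  refine (spectralTop_le_comp_isometry R.symm (-R.symm a) _).trans_eq ?_
  congr 1; ext x
  simp

/-- Translations give the whole family of minimisers; rotations carry what is known along the last
coordinate axis to every direction. -/
lemma IsMinimizer.comp_isometry {ρ : ℝ} (hρ : 0 < ρ) (hd : 1 ≤ d) {ψ : Space d → ℝ}
    (h : IsMinimizer ρ ψ) (R : Space d ≃ₗᵢ[ℝ] Space d) (a : Space d) :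
    IsMinimizer ρ fun x => ψ (R x + a) := by
  rw [isMinimizer_iff hρ hd] at h ⊢
  refine ⟨h.1.comp (R.continuous.add continuous_const), ?_, ?_⟩
  · rw [lintegral_comp_isometry R a fun x => ENNReal.ofReal (Real.exp (ψ x / ρ))]
    exact h.2.1
  · rw [spectralTop_comp_isometry]
    exact h.2.2

lemma isMinimizer_parabola {ρ : ℝ} (hρ : 0 < ρ) (hd : 1 ≤ d) :
    IsMinimizer ρ fun x : Space d => parabola d ρ x - ρ * Real.log ρ := by
  rw [isMinimizer_iff hρ hd]
  exact ⟨continuous_parabola.sub continuous_const, (lintegral_exp_parabola hρ).le,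
    le_antisymm (spectralTop_le_of_legendre_le_one hρ hd
      (continuous_parabola.sub continuous_const) (lintegral_exp_parabola hρ).le)
      (le_spectralTop_parabola hρ)⟩

end

/-! ### Uniqueness: rigidity of the transport map of a minimiser. -/

section

variable {d : ℕ} {ρ : ℝ}

/-- The remainder term in the transport proof of the logarithmic Sobolev inequality, truncated to
`[0, 1]`. -/
def truncatedRemainder (ρ κ : ℝ) (p : Space d → ℝ≥0∞) (e x : Space d) : ℝ :=
  max 0 (min (lineStretch ρ κ p e x - 1 - Real.log (lineStretch ρ κ p e x)) 1)

lemma truncatedRemainder_nonneg (κ : ℝ) (p : Space d → ℝ≥0∞) (e x : Space d) :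
    0 ≤ truncatedRemainder ρ κ p e x := le_max_left _ _

lemma truncatedRemainder_le_one (κ : ℝ) (p : Space d → ℝ≥0∞) (e x : Space d) :
    truncatedRemainder ρ κ p e x ≤ 1 := max_le zero_le_one (min_le_right _ _)

lemma measurable_truncatedRemainder (hρ : 0 < ρ) (κ : ℝ) {p : Space d → ℝ≥0∞}
    (hp : Measurable p) (e : Space d) : Measurable (truncatedRemainder ρ κ p e) := by
  have h := measurable_lineStretch (κ := κ) hρ hp e
  exact measurable_const.max (((h.sub_const 1).sub (Real.measurable_log.comp h)).min
    measurable_const)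

lemma exp_neg_le_one_sub_half {y : ℝ} (h0 : 0 ≤ y) (h1 : y ≤ 1) : Real.exp (-y) ≤ 1 - y / 2 := by
  have h2 := Real.add_one_le_exp y
  rw [Real.exp_neg, inv_le_comm₀ (Real.exp_pos y) (by linarith)]
  refine le_trans ?_ h2
  rw [inv_le_comm₀ (by linarith) (by linarith), inv_eq_one_div, div_le_iff₀ (by linarith)]
  nlinarith

/-- The remainder of a near-optimal potential is small in mean. -/
lemma IsMinimizer.lintegral_truncatedRemainder_le (hρ : 0 < ρ) (hd : 1 ≤ d) {ψ : Space d → ℝ}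
    (h : IsMinimizer ρ ψ) {i : Fin d} (hi : i.val + 1 = d) {κ : ℝ} (h0 : 0 < κ) (h1 : κ < 1) :
    ∫⁻ x, ENNReal.ofReal (truncatedRemainder ρ κ
      (fun x => ENNReal.ofReal (Real.exp (ψ x / ρ))) (unitVec i) x * Real.exp (ψ x / ρ)) ≤
    ENNReal.ofReal (-(2 * (Real.exp 1 / ρ) * d * Real.log κ)) := by
  rw [isMinimizer_iff hρ hd] at h
  obtain ⟨hψ, hZ, hΛ⟩ := h
  set F : Space d → ℝ := fun x => Real.exp (ψ x / ρ) with hF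
  have hFm : Measurable F := Real.measurable_exp.comp (hψ.measurable.div_const ρ)
  have hFpos : ∀ x, 0 < F x := fun x => Real.exp_pos _
  have hfin : ∫⁻ x, ENNReal.ofReal (F x) ≠ ⊤ := ne_top_of_le_ne_top ENNReal.ofReal_ne_top hZ
  have hFi : Integrable F volume := by
    refine ⟨hFm.aestronglyMeasurable, ?_⟩
    rw [hasFiniteIntegral_iff_ofReal (ae_of_all _ fun x => (hFpos x).le)]
    exact hfin.lt_top
  set η : Space d → ℝ := truncatedRemainder ρ κ (fun x => ENNReal.ofReal (F x)) (unitVec i) with hη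
  have hηm : Measurable η := measurable_truncatedRemainder hρ κ hFm.ennreal_ofReal _
  have hη0 : ∀ x, 0 ≤ η x := truncatedRemainder_nonneg κ _ _
  have hη1 : ∀ x, η x ≤ 1 := truncatedRemainder_le_one κ _ _
  have hηabs : ∀ x, |η x| ≤ 1 := fun x => by rw [abs_of_nonneg (hη0 x)]; exact hη1 x
  have hηF : Integrable (fun x => η x * F x) volume :=
    hFi.bdd_mul hηm.aestronglyMeasurable (ae_of_all _ hηabs)
  set Zs := Real.exp 1 / ρ with hZs
  have hZs0 : 0 < Zs := by positivity
  have hlogZs : ρ * Real.log Zs - chiValue d ρ = -chiTildeValue d ρ := by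
    rw [hZs, Real.log_div (Real.exp_pos _).ne' hρ.ne', Real.log_exp, chiTildeValue,
      log_div_exp_one hρ]
    ring
  have hFZ : ∫ x, F x ≤ Zs := by
    rw [← ofReal_integral_eq_lintegral_ofReal hFi (ae_of_all _ fun x => (hFpos x).le),
      ENNReal.ofReal_le_ofReal_iff hZs0.le] at hZ
    exact hZ
  set Y := ∫ x, η x * F x with hY
  -- A competitor with smaller mass: since exp(-η) ≤ 1 - η/2 on [0, 1], its integral is at most Zs -
  -- Y/2.
  set F' : Space d → ℝ := fun x => F x * Real.exp (-η x) with hF'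
  have hF'm : Measurable F' := hFm.mul (Real.measurable_exp.comp hηm.neg)
  have hF'pos : ∀ x, 0 < F' x := fun x => mul_pos (hFpos x) (Real.exp_pos _)
  have hF'le : ∀ x, F' x ≤ F x - η x * F x / 2 := fun x => by
    have := mul_le_mul_of_nonneg_left (exp_neg_le_one_sub_half (hη0 x) (hη1 x)) (hFpos x).le
    simp only [hF']; linarith
  have hF'i : Integrable F' volume := by
    refine hFi.mono' hF'm.aestronglyMeasurable (ae_of_all _ fun x => ?_)
    rw [Real.norm_of_nonneg (hF'pos x).le]
    have := mul_nonneg (hη0 x) (hFpos x).le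
    linarith [hF'le x]
  have hF'Z : ∫ x, F' x ≤ Zs - Y / 2 := by
    have : ∫ x, F' x ≤ ∫ x, (F x - η x * F x / 2) :=
      integral_mono hF'i (hFi.sub (hηF.div_const 2)) hF'le
    rw [integral_sub hFi (hηF.div_const 2), integral_div] at this
    linarith
  have hlint : ∀ G : Space d → ℝ, Integrable G volume → (∀ x, 0 < G x) →
      (∫⁻ x, ENNReal.ofReal (G x)).toReal = ∫ x, G x ∧ 0 < ∫ x, G x := fun G hG hG0 => by
    have e := ofReal_integral_eq_lintegral_ofReal hG (ae_of_all _ fun x => (hG0 x).le)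
    refine ⟨by rw [← e, ENNReal.toReal_ofReal (integral_nonneg fun x => (hG0 x).le)], ?_⟩
    rw [integral_pos_iff_support_of_nonneg (fun x => (hG0 x).le) hG]
    have : Function.support G = Set.univ := by
      ext x; simpa using (hG0 x).ne'
    rw [this]
    exact Measure.measure_univ_pos.2 (NeZero.ne _)
  suffices hs : Y ≤ -(2 * Zs * d * Real.log κ) by
    rw [← ofReal_integral_eq_lintegral_ofReal hηF
      (ae_of_all _ fun x => mul_nonneg (hη0 x) (hFpos x).le)]
    exact ENNReal.ofReal_le_ofReal hs
  -- Each of two comparisons with an ε-optimal g costs ε, and the error in the inequality for F'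
  -- costs a third.
  suffices hs : ∀ ε : ℝ, 0 < ε → ρ * Y / (2 * Zs) ≤ -(d * ρ * Real.log κ) + 3 * ε by
    have h3 : ρ * Y / (2 * Zs) ≤ -(d * ρ * Real.log κ) := by
      refine le_of_forall_pos_le_add fun ε hε => ?_
      have := hs (ε / 3) (by positivity)
      linarith
    rw [div_le_iff₀ (by positivity)] at h3
    have h4 : ρ * Y ≤ ρ * -(2 * Zs * d * Real.log κ) := by linarith
    exact le_of_mul_le_mul_left h4 hρ
  intro ε hε
  have hlt : ((-chiTildeValue d ρ - ε : ℝ) : EReal) < spectralTop ψ := by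
    rw [hΛ, EReal.coe_lt_coe_iff]; linarith
  obtain ⟨_, ⟨g, v, hgv, hg, -, rfl⟩, hlt⟩ := lt_sSup_iff.1 hlt
  have hg1 := integral_sq_eq_one hgv.1 hg
  set N := ∫ x, ‖v x‖ ^ 2
  have hηg : Integrable (fun x => η x * g x ^ 2) volume :=
    MemLp.integrable_bdd_mul_sq hgv.1 hηm hηabs
  have hfrom : ∀ V : Space d → ℝ, Integrable V volume →
      (∀ᵐ x : Space d, ψ x * g x ^ 2 ≤ V x) → -chiTildeValue d ρ - ε < (∫ x, V x) - N := by
    intro V hV hle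
    have := hlt.trans_le (EReal.sub_le_sub (extIntegral_le_of_ae_le hV hle) le_rfl)
    exact_mod_cast this
  have hlogF : ∀ x, ρ * Real.log (F x) = ψ x := fun x => by
    simp only [hF, Real.log_exp]; field_simp
  obtain ⟨U, hU, hUle, hUint⟩ := hgv.exists_log_bound hρ h0 h1 hFm hFpos hfin i hi hg1
  -- The inequality for F with remainder bounds ρ ∫ η g² above by -dρ log κ + ε.
  have b1 := hfrom (fun x => U x - ρ * (η x * g x ^ 2)) (hU.sub (hηg.const_mul ρ)) (by
    filter_upwards [hUle, ae_lineStretch_remainder_nonneg hρ h0 hFm hFpos hfin hi] with x hx hw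
    rw [hlogF] at hx
    have h5 : η x ≤ lineStretch ρ κ (fun x => ENNReal.ofReal (F x)) (unitVec i) x - 1 -
        Real.log (lineStretch ρ κ (fun x => ENNReal.ofReal (F x)) (unitVec i) x) :=
      max_le hw (min_le_left _ _)
    have := mul_le_mul_of_nonneg_left (mul_le_mul_of_nonneg_right h5 (sq_nonneg (g x))) hρ.le
    linarith)
  rw [integral_sub hU (hηg.const_mul ρ), integral_const_mul] at b1
  obtain ⟨e1, p1⟩ := hlint F hFi hFpos
  obtain ⟨e2, p2⟩ := hlint F' hF'i hF'pos
  rw [e1] at hUint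
  have hF'fin : ∫⁻ x, ENNReal.ofReal (F' x) ≠ ⊤ := hF'i.lintegral_lt_top.ne
  obtain ⟨U', hU', hUle', hUint'⟩ := hgv.exists_log_bound_of_pos hρ hd hF'm hF'pos hF'fin hg1 hε
  -- The inequality for F', whose potential is ψ - ρη, bounds ρ ∫ η g² below by ρY/(2 Zs) - 2ε, once
  -- log ∫ F' is estimated as in `l2`.
  have b2 := hfrom (fun x => U' x + ρ * (η x * g x ^ 2)) (hU'.add (hηg.const_mul ρ)) (by
    filter_upwards [hUle'] with x hx
    have : ρ * Real.log (F' x) = ψ x - ρ * η x := by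
      simp only [hF']
      rw [Real.log_mul (hFpos x).ne' (Real.exp_pos _).ne', mul_add, hlogF, Real.log_exp]
      ring
    rw [this] at hx
    linarith)
  rw [integral_add hU' (hηg.const_mul ρ), integral_const_mul] at b2
  rw [e2] at hUint'
  have l1 := mul_le_mul_of_nonneg_left (Real.log_le_log p1 hFZ) hρ.le
  have l2 : Real.log (∫ x, F' x) ≤ Real.log Zs - Y / (2 * Zs) := by
    have h6 := Real.log_le_sub_one_of_pos (div_pos p2 hZs0)
    rw [Real.log_div p2.ne' hZs0.ne'] at h6
    have h7 : (∫ x, F' x) / Zs ≤ 1 - Y / (2 * Zs) := by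
      rw [div_le_iff₀ hZs0]
      have : (1 - Y / (2 * Zs)) * Zs = Zs - Y / 2 := by field_simp
      linarith
    linarith
  have l3 := mul_le_mul_of_nonneg_left l2 hρ.le
  have l4 : ρ * (Real.log Zs - Y / (2 * Zs)) = ρ * Real.log Zs - ρ * Y / (2 * Zs) := by ring
  linarith

section Line

variable {F : Space d → ℝ} {e x : Space d}

lemma hasDerivAt_lineCdf (hF : Continuous F) (hpos : ∀ x, 0 < F x)
    (hx : lineMass (fun x => ENNReal.ofReal (F x)) e x ≠ ⊤) (s : ℝ) :
    HasDerivAt (fun s : ℝ => lineCdf (fun x => ENNReal.ofReal (F x)) e (x + s • e))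
      (ENNReal.ofReal (F (x + s • e)) /
        lineMass (fun x => ENNReal.ofReal (F x)) e x).toReal s := by
  set p : Space d → ℝ≥0∞ := fun x => ENNReal.ofReal (F x) with hp
  have hpm : Measurable p := hF.measurable.ennreal_ofReal
  have h0 := lineMass_ne_zero hpm (fun x => by simpa [hp] using hpos x) e x
  have hc : Continuous fun t : ℝ => (p (x + t • e) / lineMass p e x).toReal := by
    simp only [hp, ENNReal.toReal_div]
    refine Continuous.div_const ?_ _
    simp only [ENNReal.toReal_ofReal (hpos _).le]
    fun_prop
  have := (intervalIntegral.integral_hasDerivAt_right (hc.intervalIntegrable 0 s)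
    (hc.stronglyMeasurableAtFilter _ _) hc.continuousAt).const_add (lineCdf p e x)
  exact this.congr_of_eventuallyEq (Eventually.of_forall fun s =>
    lineCdf_add_smul_eq_integral hpm h0 hx s)

/-- A positive density makes the distribution function strictly increasing, so it never reaches 0 or
1; hence the untruncated transport κ = 1 makes sense at every point of the line. -/
lemma lineCdf_mem_Ioo (hF : Continuous F) (hpos : ∀ x, 0 < F x)
    (hx : lineMass (fun x => ENNReal.ofReal (F x)) e x ≠ ⊤) (s : ℝ) :
    lineCdf (fun x => ENNReal.ofReal (F x)) e (x + s • e) ∈ Set.Ioo (0 : ℝ) 1 := by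
  have h0 := lineMass_ne_zero (p := fun x => ENNReal.ofReal (F x)) hF.measurable.ennreal_ofReal
    (fun x => by simpa using hpos x) e x
  have hm : StrictMono fun s : ℝ => lineCdf (fun x => ENNReal.ofReal (F x)) e (x + s • e) :=
    strictMono_of_hasDerivAt_pos (hasDerivAt_lineCdf hF hpos hx) fun s =>
      ENNReal.toReal_pos (ENNReal.div_ne_zero.2 ⟨by simpa using hpos _, hx⟩)
        (ENNReal.div_ne_top ENNReal.ofReal_ne_top h0)
  exact ⟨(lineCdf_mem_Icc _ _).1.trans_lt (hm (sub_one_lt s)),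
    (hm (lt_add_one s)).trans_le (lineCdf_mem_Icc _ _).2⟩

lemma tendsto_lineStretch (hρ : 0 < ρ) {p : Space d → ℝ≥0∞}
    (hmem : lineCdf p e x ∈ Set.Ioo (0 : ℝ) 1) {κ : ℕ → ℝ} (hκ : Tendsto κ atTop (𝓝 1)) :
    Tendsto (fun n => lineStretch ρ (κ n) p e x) atTop (𝓝 (lineStretch ρ 1 p e x)) := by
  have h1 : Tendsto (fun n => (1 - κ n) / 2 + κ n * lineCdf p e x) atTop
      (𝓝 ((1 - 1) / 2 + 1 * lineCdf p e x)) :=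
    ((hκ.const_sub 1).div_const 2).add (hκ.mul_const _)
  have h2 : (1 - 1) / 2 + 1 * lineCdf p e x ∈ Set.Ioo (0 : ℝ) 1 := by simpa using hmem
  have h3 := (hasDerivAt_gaussQuantile hρ h2).continuousAt.tendsto.comp h1
  have h4 := ((continuous_gaussDensity ρ).tendsto _).comp h3
  exact (hκ.mul_const _).div h4 (gaussDensity_pos hρ _).ne'

end Line

lemma tendsto_truncatedRemainder (hρ : 0 < ρ) {p : Space d → ℝ≥0∞} {e x : Space d}
    (hmem : lineCdf p e x ∈ Set.Ioo (0 : ℝ) 1) (hpos : lineStretch ρ 1 p e x ≠ 0)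
    {κ : ℕ → ℝ} (hκ : Tendsto κ atTop (𝓝 1)) :
    Tendsto (fun n => truncatedRemainder ρ (κ n) p e x) atTop
      (𝓝 (truncatedRemainder ρ 1 p e x)) := by
  have h := tendsto_lineStretch hρ hmem hκ
  exact tendsto_const_nhds.max (((h.sub_const 1).sub (h.log hpos)).min tendsto_const_nhds)

/-- The transport map of a minimiser has unit derivative. -/
lemma IsMinimizer.ae_lineStretch_eq_one (hρ : 0 < ρ) (hd : 1 ≤ d) {ψ : Space d → ℝ}
    (h : IsMinimizer ρ ψ) {i : Fin d} (hi : i.val + 1 = d) :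
    ∀ᵐ x : Space d, lineStretch ρ 1 (fun x => ENNReal.ofReal (Real.exp (ψ x / ρ))) (unitVec i) x
      = 1 := by
  have hmin := h
  rw [isMinimizer_iff hρ hd] at h
  obtain ⟨hψ, hZ, -⟩ := h
  set F : Space d → ℝ := fun x => Real.exp (ψ x / ρ) with hF
  have hFc : Continuous F := by fun_prop
  have hFpos : ∀ x, 0 < F x := fun x => Real.exp_pos _
  have hfin : ∫⁻ x, ENNReal.ofReal (F x) ≠ ⊤ := ne_top_of_le_ne_top ENNReal.ofReal_ne_top hZ
  set p : Space d → ℝ≥0∞ := fun x => ENNReal.ofReal (F x) with hp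
  have hpm : Measurable p := hFc.measurable.ennreal_ofReal
  have hp0 : ∀ x, p x ≠ 0 := fun x => by simpa [hp] using hFpos x
  set κ : ℕ → ℝ := fun n => Real.exp (-(1 / ((n : ℝ) + 1))) with hκ
  have hκ0 : ∀ n, 0 < κ n := fun n => Real.exp_pos _
  have hκ1 : ∀ n, κ n < 1 := fun n => by
    rw [hκ, Real.exp_lt_one_iff]
    have : 0 < 1 / ((n : ℝ) + 1) := Nat.one_div_pos_of_nat
    linarith
  have hτ := tendsto_one_div_add_atTop_nhds_zero_nat (𝕜 := ℝ)
  have hκt : Tendsto κ atTop (𝓝 1) := by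
    have := (Real.continuous_exp.tendsto _).comp hτ.neg
    rw [neg_zero, Real.exp_zero] at this
    exact this
  have hmass := ae_lineMass_ne_top hpm hfin hi
  have hstretch : ∀ᵐ x : Space d, 0 < lineStretch ρ 1 p (unitVec i) x := by
    filter_upwards [hmass] with x hx
    exact (log_lineStretch hρ one_pos (hp0 x) ENNReal.ofReal_ne_top
      (lineMass_ne_zero hpm hp0 _ x) hx).1
  have hmeas := fun k => measurable_truncatedRemainder hρ k hpm (unitVec i)
  -- Fatou's lemma as κ → 1: the bound is a multiple of -log κ, which tends to 0.
  have hzero : ∫⁻ x, ENNReal.ofReal (truncatedRemainder ρ 1 p (unitVec i) x * F x) = 0 := by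
    apply le_antisymm _ (zero_le)
    calc _ = ∫⁻ x, liminf (fun n => ENNReal.ofReal
          (truncatedRemainder ρ (κ n) p (unitVec i) x * F x)) atTop := by
          apply lintegral_congr_ae
          filter_upwards [hmass, hstretch] with x hx hs
          have hm := lineCdf_mem_Ioo hFc hFpos hx 0
          rw [zero_smul, add_zero] at hm
          exact ((ENNReal.tendsto_ofReal
            ((tendsto_truncatedRemainder hρ hm hs.ne' hκt).mul_const _)).liminf_eq).symm
      _ ≤ liminf (fun n => ∫⁻ x, ENNReal.ofReal
          (truncatedRemainder ρ (κ n) p (unitVec i) x * F x)) atTop :=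
          lintegral_liminf_le fun n => ((hmeas _).mul hFc.measurable).ennreal_ofReal
      _ ≤ liminf (fun n => ENNReal.ofReal
          (-(2 * (Real.exp 1 / ρ) * d * Real.log (κ n)))) atTop :=
          liminf_le_liminf (Eventually.of_forall fun n =>
            hmin.lintegral_truncatedRemainder_le hρ hd hi (hκ0 n) (hκ1 n))
      _ = 0 := by
          apply Tendsto.liminf_eq
          have h1 : Tendsto (fun n => -(2 * (Real.exp 1 / ρ) * d * Real.log (κ n))) atTop
              (𝓝 0) := by
            have := (hκt.log one_ne_zero).const_mul (-(2 * (Real.exp 1 / ρ) * d))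
            simpa using this
          simpa using ENNReal.tendsto_ofReal h1
  have hprod : Measurable fun x => truncatedRemainder ρ 1 p (unitVec i) x * F x :=
    (hmeas 1).mul hFc.measurable
  rw [lintegral_eq_zero_iff hprod.ennreal_ofReal] at hzero
  filter_upwards [hzero, hstretch] with x hx hs
  simp only [Pi.zero_apply, ENNReal.ofReal_eq_zero] at hx
  have h1 : truncatedRemainder ρ 1 p (unitVec i) x ≤ 0 := by
    by_contra hc
    exact absurd hx (not_le.2 (mul_pos (not_le.1 hc) (hFpos x)))
  by_contra hne
  have h2 := Real.log_lt_sub_one_of_pos hs hne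
  have h3 : 0 < truncatedRemainder ρ 1 p (unitVec i) x :=
    lt_max_of_lt_right (lt_min (by linarith) one_pos)
  linarith

/-- Along lines in the last coordinate direction, a minimiser is a parabola. -/
lemma IsMinimizer.second_difference_last (hρ : 0 < ρ) (hd : 1 ≤ d) {ψ : Space d → ℝ}
    (h : IsMinimizer ρ ψ) {i : Fin d} (hi : i.val + 1 = d) (x : Space d) (t : ℝ) :
    ψ (x + t • unitVec i) + ψ (x - t • unitVec i) - 2 * ψ x = -2 * ρ ^ 2 * t ^ 2 := by
  have hone := h.ae_lineStretch_eq_one hρ hd hi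
  rw [isMinimizer_iff hρ hd] at h
  obtain ⟨hψ, hZ, -⟩ := h
  set F : Space d → ℝ := fun x => Real.exp (ψ x / ρ) with hF
  have hFc : Continuous F := by fun_prop
  have hFpos : ∀ x, 0 < F x := fun x => Real.exp_pos _
  have hfin : ∫⁻ x, ENNReal.ofReal (F x) ≠ ⊤ := ne_top_of_le_ne_top ENNReal.ofReal_ne_top hZ
  set p : Space d → ℝ≥0∞ := fun x => ENNReal.ofReal (F x) with hp
  have hpm : Measurable p := hFc.measurable.ennreal_ofReal
  have hp0 : ∀ x, p x ≠ 0 := fun x => by simpa [hp] using hFpos x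
  set e : Space d := unitVec i
  rw [← ae_ae_line_iff (P := fun x => lineStretch ρ 1 p e x = 1) (measurable_lineStretch hρ hpm e (measurableSet_singleton 1)) e] at hone
  have hae : ∀ᵐ x : Space d,
      ψ (x + t • e) + ψ (x - t • e) - 2 * ψ x = -2 * ρ ^ 2 * t ^ 2 := by
    filter_upwards [hone, ae_lineMass_ne_top hpm hfin hi] with x hx hm
    have hmem : ∀ s : ℝ, (1 - 1) / 2 + 1 * lineCdf p e (x + s • e) ∈ Set.Ioo (0 : ℝ) 1 :=
      fun s => by simpa using lineCdf_mem_Ioo hFc hFpos hm s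
    have hder := fun s => hasDerivAt_lineTransport hρ (hmem s) (by
      have := hasDerivAt_lineCdf hFc hFpos hm s
      exact this)
    have hTc : Continuous fun s : ℝ => lineTransport ρ 1 p e (x + s • e) :=
      continuous_iff_continuousAt.2 fun s => (hder s).continuousAt
    have hDc : Continuous fun s : ℝ => lineStretch ρ 1 p e (x + s • e) := by
      unfold lineStretch
      refine Continuous.div ?_ ((continuous_gaussDensity ρ).comp hTc)
        fun s => (gaussDensity_pos hρ _).ne'
      simp only [lineMass_add_smul, hp, ENNReal.toReal_div, ENNReal.toReal_ofReal (hFpos _).le]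
      fun_prop
    -- Continuity along the line upgrades almost every s to every s, so T is a translation on this
    -- line.
    have hD1 : ∀ s, lineStretch ρ 1 p e (x + s • e) = 1 := fun s =>
      congrFun ((hDc.ae_eq_iff_eq volume continuous_const).1 hx) s
    have hT : ∀ s, lineTransport ρ 1 p e (x + s • e) = s + lineTransport ρ 1 p e x := by
      have hd0 : ∀ s, HasDerivAt (fun s : ℝ => lineTransport ρ 1 p e (x + s • e) - s) 0 s :=
        fun s => by
          have := (hder s).sub (hasDerivAt_id s)
          rw [hD1, sub_self] at this
          exact this
      intro s
      have := is_const_of_deriv_eq_zero (fun s => (hd0 s).differentiableAt)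
        (fun s => (hd0 s).deriv) s 0
      simp only [zero_smul, add_zero, sub_zero] at this
      linarith
    -- `log_lineStretch` with stretch 1 and κ = 1, solved for ψ; taking second differences removes
    -- the unknown mass and shift.
    have hψs : ∀ s : ℝ, ψ (x + s • e) = ρ * (Real.log (lineMass p e x).toReal +
        1 / 2 * Real.log (ρ / Real.pi)) - ρ ^ 2 * (s + lineTransport ρ 1 p e x) ^ 2 := fun s => by
      have := (log_lineStretch hρ one_pos (hp0 (x + s • e)) ENNReal.ofReal_ne_top
        (lineMass_ne_zero hpm hp0 e _) (by rwa [lineMass_add_smul])).2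
      rw [hD1, hT, lineMass_add_smul, ENNReal.toReal_ofReal (hFpos _).le, Real.log_one, hF,
        Real.log_exp] at this
      have h2 : ψ (x + s • e) = ρ * (ψ (x + s • e) / ρ) := by field_simp
      rw [h2]
      linear_combination (-ρ) * this
    have e0 := hψs 0
    have e1 := hψs t
    have e2 := hψs (-t)
    rw [zero_smul, add_zero] at e0
    rw [neg_smul, ← sub_eq_add_neg] at e2
    rw [e0, e1, e2]; ring
  have hcont : Continuous fun x : Space d => ψ (x + t • e) + ψ (x - t • e) - 2 * ψ x := by fun_prop
  exact congrFun ((hcont.ae_eq_iff_eq volume continuous_const).1 hae) x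

/-- A reflection maps the multiple of the last unit vector of length ‖w‖ to w, and ψ composed with
it is again a minimiser. -/
lemma IsMinimizer.second_difference (hρ : 0 < ρ) (hd : 1 ≤ d) {ψ : Space d → ℝ}
    (h : IsMinimizer ρ ψ) (x w : Space d) :
    ψ (x + w) + ψ (x - w) - 2 * ψ x = -2 * ρ ^ 2 * ‖w‖ ^ 2 := by
  have hi : (⟨d - 1, by omega⟩ : Fin d).val + 1 = d := by simp; omega
  set u : Space d := ‖w‖ • unitVec ⟨d - 1, by omega⟩ with hu
  have hn : ‖u‖ = ‖w‖ := by simp [hu, norm_smul, unitVec]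
  set R : Space d ≃ₗᵢ[ℝ] Space d := (Submodule.span ℝ {u - w})ᗮ.reflection
  have hR : R u = w := Submodule.reflection_sub hn
  have := (h.comp_isometry hρ hd R 0).second_difference_last hρ hd hi (R.symm x) ‖w‖
  rw [← hu] at this
  simpa [hR] using this

/-- A continuous function with vanishing second differences is affine. -/
lemma exists_inner_of_second_difference_eq_zero {h : Space d → ℝ} (hc : Continuous h)
    (h2 : ∀ x w, h (x + w) + h (x - w) = 2 * h x) :
    ∃ b : Space d, ∀ x, h x = inner ℝ b x + h 0 := by
  have hadd : ∀ x y, h (x + y) - h 0 = (h x - h 0) + (h y - h 0) := by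
    intro x y
    -- Both x, y and x + y, 0 have midpoint (x + y)/2, so h x + h y = h (x + y) + h 0.
    have e1 := h2 ((1 / 2 : ℝ) • (x + y)) ((1 / 2 : ℝ) • (x - y))
    have e2 := h2 ((1 / 2 : ℝ) • (x + y)) ((1 / 2 : ℝ) • (x + y))
    have s1 : (1 / 2 : ℝ) • (x + y) + (1 / 2 : ℝ) • (x - y) = x := by module
    have s2 : (1 / 2 : ℝ) • (x + y) - (1 / 2 : ℝ) • (x - y) = y := by module
    have s3 : (1 / 2 : ℝ) • (x + y) + (1 / 2 : ℝ) • (x + y) = x + y := by module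
    rw [s1, s2] at e1
    rw [s3, sub_self] at e2
    linarith
  set A : Space d →+ ℝ := ⟨⟨fun x => h x - h 0, by simp⟩, hadd⟩ with hA
  have hAc : Continuous A := hc.sub continuous_const
  set L : Space d →L[ℝ] ℝ := A.toRealLinearMap hAc
  refine ⟨(InnerProductSpace.toDual ℝ (Space d)).symm L, fun x => ?_⟩
  rw [InnerProductSpace.toDual_symm_apply]
  have : L x = h x - h 0 := rfl
  rw [this]; ring

lemma IsMinimizer.eq_parabola (hρ : 0 < ρ) (hd : 1 ≤ d) {ψ : Space d → ℝ}
    (h : IsMinimizer ρ ψ) :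
    ∃ a : Space d, ψ = fun x => parabola d ρ (x - a) - ρ * Real.log ρ := by
  have hsd := h.second_difference hρ hd
  rw [isMinimizer_iff hρ hd] at h
  obtain ⟨hψ, hZ, hΛ⟩ := h
  obtain ⟨b, hb⟩ := exists_inner_of_second_difference_eq_zero
    (h := fun x => ψ x + ρ ^ 2 * ‖x‖ ^ 2) (by fun_prop) (by
      intro x w
      have h1 := hsd x w
      have h2 := parallelogram_law_with_norm ℝ x w
      beta_reduce
      linear_combination h1 + ρ ^ 2 * h2)
  -- Completing the square in -ρ²|x|² + ⟨b, x⟩.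
  set a : Space d := (1 / (2 * ρ ^ 2)) • b with ha
  obtain ⟨r, hr⟩ : ∃ r : ℝ, ∀ x, ψ x = parabola d ρ (x - a) - ρ * Real.log ρ + r := by
    refine ⟨ψ 0 + ρ ^ 2 * ‖a‖ ^ 2 - ρ - ρ * ((d : ℝ) / 2) * Real.log (ρ / Real.pi) +
      ρ * Real.log ρ, fun x => ?_⟩
    have h1 := hb x
    simp only [norm_zero] at h1
    have h2 : inner ℝ b x = 2 * ρ ^ 2 * inner ℝ x a := by
      rw [ha, inner_smul_right, real_inner_comm]; field_simp
    rw [parabola, norm_sub_sq_real]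
    linear_combination h1 + h2
  have hshift : ∫⁻ x, ENNReal.ofReal (Real.exp (ψ x / ρ)) =
      ENNReal.ofReal (Real.exp (r / ρ) * (Real.exp 1 / ρ)) := by
    have e1 : ∀ x, ENNReal.ofReal (Real.exp (ψ x / ρ)) = ENNReal.ofReal (Real.exp (r / ρ)) *
        ENNReal.ofReal (Real.exp ((parabola d ρ (x - a) - ρ * Real.log ρ) / ρ)) := fun x => by
      rw [← ENNReal.ofReal_mul (Real.exp_pos _).le, ← Real.exp_add, hr]
      congr 2; ring
    simp only [e1]
    rw [lintegral_const_mul' _ _ ENNReal.ofReal_ne_top, lintegral_sub_right_eq_self (fun x =>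
      ENNReal.ofReal (Real.exp ((parabola d ρ x - ρ * Real.log ρ) / ρ))) a,
      lintegral_exp_parabola hρ, ENNReal.ofReal_mul (Real.exp_pos _).le]
  -- The constant r multiplies the exponential integral by exp(r/ρ), and the parabola already
  -- saturates the constraint.
  have hupper : r ≤ 0 := by
    rw [hshift, ENNReal.ofReal_le_ofReal_iff (by positivity)] at hZ
    have h1 : Real.exp (r / ρ) ≤ 1 := by
      have h2 : 0 < Real.exp 1 / ρ := by positivity
      nlinarith
    rw [Real.exp_le_one_iff] at h1
    by_contra hc
    exact absurd h1 (not_le.2 (div_pos (not_le.1 hc) hρ))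
  -- By `spectralTop_le` the top of the spectrum is at most `-chiTildeValue d ρ + r`, while
  -- optimality makes it `-chiTildeValue d ρ`.
  have hlower : 0 ≤ r := by
    have h1 := spectralTop_le hρ hd hψ.measurable
      (by rw [hshift]; exact ENNReal.ofReal_ne_top)
    rw [hΛ, hshift, ENNReal.toReal_ofReal (by positivity), EReal.coe_le_coe_iff,
      Real.log_mul (Real.exp_pos _).ne' (by positivity), Real.log_exp,
      Real.log_div (Real.exp_pos _).ne' hρ.ne', Real.log_exp, chiTildeValue,
      log_div_exp_one hρ] at h1
    have h2 : ρ * (r / ρ + (1 - Real.log ρ)) = r + ρ * (1 - Real.log ρ) := by field_simp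
    linarith
  refine ⟨a, funext fun x => ?_⟩
  rw [hr, le_antisymm hupper hlower, add_zero]

end

end AlmostBounded

end

/-- The function `ψ_ρ - ρ log ρ` is a minimiser of the variational problem for `χ̃(ρ)`; the
minimisers are exactly its spatial translates; and `χ̃(ρ) = χ(ρ) + ρ log (ρ/e)`, an identity
between real numbers. -/
theorem proposition1p10 (d : ℕ) (hd : 1 ≤ d) (ρ : ℝ) (hρ : 0 < ρ) :
    AlmostBounded.IsMinimizer ρ (fun x : AlmostBounded.Space d =>
      AlmostBounded.parabola d ρ x - ρ * Real.log ρ) ∧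
    (∀ ψ : AlmostBounded.Space d → ℝ, AlmostBounded.IsMinimizer ρ ψ ↔
      ∃ a : AlmostBounded.Space d,
        ψ = fun x => AlmostBounded.parabola d ρ (x - a) - ρ * Real.log ρ) ∧
    ∃ c : ℝ, AlmostBounded.chi d ρ = (c : EReal) ∧
      AlmostBounded.chiTilde d ρ = ((c + ρ * Real.log (ρ / Real.exp 1) : ℝ) : EReal) := by
  refine ⟨AlmostBounded.isMinimizer_parabola hρ hd, fun ψ => ⟨fun h => h.eq_parabola hρ hd, ?_⟩,
    AlmostBounded.chiValue d ρ, AlmostBounded.chi_eq hρ hd, AlmostBounded.chiTilde_eq hρ hd⟩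
  rintro ⟨a, rfl⟩
  have h := (AlmostBounded.isMinimizer_parabola hρ hd).comp_isometry hρ hd
    (LinearIsometryEquiv.refl ℝ _) (-a)
  simpa [sub_eq_add_neg] using h
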